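/- **Setting.** Let $H=\mathbb R^n\times C$ with $C$ a finite discrete abelian group, and let $\Gamma\subset H\times\mathbb R^d$ be a lattice (discrete, cocompact subgroup) on which the projection $\pi^{\|}$ to $\mathbb R^d$ is injective and whose projection $\pi^{\perp}(\Gamma)$ to $H$ is dense. For $x\in\pi^{\|}(\Gamma)$ let $x^*\in H$ be the unique element with $(x^*,x)\in\Gamma$. Let $W\subset H$ be compact, the closure of its interior, and such that $W+h=W$ only for $h=0$. For $\xi\in H\times\mathbb R^d$ put $\Lambda_\xi=\{\pi^{\|}(\gamma):\gamma\in\Gamma+\xi,\ \pi^\perp(\gamma)\in W\}$; $\xi$ is *non-singular* if $\pi^\perp(\Gamma+\xi)\cap\partial W=\emptyset$. Two point sets are close if their restrictions to a large ball about the origin are close in the Hausdorff distance. The hull $\Omega_\Lambda$ is the closure of $\{\Lambda-t:t\in\mathbb R^d\}$, and the transversal $\Xi_\Lambda$ is the closure of $\{\Lambda-x:x\in\Lambda\}$. A *model set with window $W$* is an element $M$ of the hull of some $\Lambda_\xi$ with $\xi$ non-singular. Let $\pi(M)\in(H\times\mathbb R^d)/\Gamma$ be the value at $M$ of the continuous extension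 of the map $\Lambda_\xi\mapsto[\xi]$ ($\xi$ non-singular). The star map $\sigma_M:M\to H$ sends $x\in M$ to the unique $h\in H$ with $[(h,x)]=\pi(M)$. For compact $B\subset\mathbb R^d$ and a patch $P=M'\cap B$ with $0\in P$, where $M'$ is a model set with window $W$, the *acceptance domain* of $P$ is the closure of $\bigcap_{x\in P}(\mathrm{Int}(W)-x^*)\cap\bigcap_{x'\in P'}(W^c-x'^*)$, where $P'=\{x'\in\pi^{\|}(\Gamma)\cap B: x'^*\in W-W\}\setminus P$. Assume that each such acceptance domain is a finite union of closed convex sets with nonempty interior (a convex subset of $\mathbb R^n\times C$ being a convex subset of one copy $\mathbb R^n\times\{c\}$). For a function $\varphi$ on $M$: $\varphi$ is *strongly pattern equivariant* if there is $R>0$ such that $\varphi(x_1)=\varphi(x_2)$ whenever $M-x_1$ and $M-x_2$ agree on $B_R(0)$. It is *weakly pattern equivariant* if $\varphi(x)=\tilde\varphi(M-x)$ for a (necessarily unique) continuous $\tilde\varphi$ on $\Xi_M$. A weakly pattern equivariant $\varphi$ is *nonslip* if there is $\epsilon>0$ such that $\tilde\varphi(M_1)=\tilde\varphi(M_2)$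 whenever $M_1,M_2\in\Xi_M$ have the same image in the maximal equicontinuous factor of $(\Omega_M,\mathbb R^d)$ and agree out to radius $\epsilon^{-1}$. For real-valued $\varphi$, the coboundary $\delta\varphi(x_1,x_2)=\varphi(x_2)-\varphi(x_1)$ is *strongly pattern equivariant* if for every $r$ there is $R>0$ such that $\delta\varphi(x_1,x_2)=\delta\varphi(y_1,y_2)$ whenever $x_1,x_2,y_1,y_2\in M$, $x_2-x_1=y_2-y_1$ has length at most $r$, and $M-x_1$, $M-y_1$ agree on $B_R(0)$. **Theorem.** Let $M$ be a model set with window $W$ as above and let $F:M\to\mathbb R$ be weakly pattern equivariant and nonslip, with strongly pattern equivariant coboundary. Then there are a continuous linear map $L:H\to\mathbb R$ (that is, a continuous linear map on $\mathbb R^n$, extended to $\mathbb R^n\times C$ by zero on $C$) and a strongly pattern equivariant $\psi:M\to\mathbb R$ such that $F(x)=L(\sigma_M(x))+\psi(x)$ for all $x\in M$. -/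

import Mathlib

open Set Filter Topology

/-! ### The local topology on point sets -/

section PointSets

variable {E : Type} [NormedAddCommGroup E]

/-- `A` and `B` are `ε`-close: their restrictions to the ball of radius `1 / ε` about the origin
are within `ε` of each other, in the sense of the Hausdorff distance. -/
def LocallyClose (ε : ℝ) (A B : Set E) : Prop :=
  (∀ a ∈ A, ‖a‖ ≤ ε⁻¹ → ∃ b ∈ B, dist a b < ε) ∧ (∀ b ∈ B, ‖b‖ ≤ ε⁻¹ → ∃ a ∈ A, dist a b < ε)

theorem LocallyClose.mono {ε δ : ℝ} (hδ : 0 < δ) (h : δ ≤ ε) {A B : Set E}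
    (hAB : LocallyClose δ A B) : LocallyClose ε A B := by
  have hi : ε⁻¹ ≤ δ⁻¹ := inv_anti₀ hδ h
  refine ⟨fun a ha hn => ?_, fun b hb hn => ?_⟩
  · obtain ⟨b, hb, hd⟩ := hAB.1 a ha (hn.trans hi)
    exact ⟨b, hb, hd.trans_le h⟩
  · obtain ⟨a, ha, hd⟩ := hAB.2 b hb (hn.trans hi)
    exact ⟨a, ha, hd.trans_le h⟩

theorem LocallyClose.symm {ε : ℝ} {A B : Set E} (h : LocallyClose ε A B) : LocallyClose ε B A :=
  ⟨fun b hb hn => let ⟨a, ha, hd⟩ := h.2 b hb hn; ⟨a, ha, by rwa [dist_comm]⟩,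
    fun a ha hn => let ⟨b, hb, hd⟩ := h.1 a ha hn; ⟨b, hb, by rwa [dist_comm]⟩⟩

theorem LocallyClose.comp {ε : ℝ} (hε : 0 < ε) {A B D : Set E}
    (h₁ : LocallyClose (min (ε / 2) ε⁻¹) A B) (h₂ : LocallyClose (min (ε / 2) ε⁻¹) B D) :
    LocallyClose ε A D := by
  have key : ∀ {A B D : Set E}, LocallyClose (min (ε / 2) ε⁻¹) A B →
      LocallyClose (min (ε / 2) ε⁻¹) B D → ∀ a ∈ A, ‖a‖ ≤ ε⁻¹ → ∃ b ∈ D, dist a b < ε := by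
    intro A B D h₁ h₂ a ha hn
    have hi : 0 < ε⁻¹ := inv_pos.mpr hε
    have hpos : 0 < min (ε / 2) ε⁻¹ := lt_min (by linarith) hi
    have h2 : 2 * ε⁻¹ ≤ (min (ε / 2) ε⁻¹)⁻¹ := by
      have : (ε / 2)⁻¹ ≤ (min (ε / 2) ε⁻¹)⁻¹ := inv_anti₀ hpos (min_le_left _ _)
      rwa [inv_div, div_eq_mul_inv] at this
    obtain ⟨b, hb, hab⟩ := h₁.1 a ha (by linarith)
    have hb' : ‖b‖ ≤ ‖a‖ + dist a b := by
      have := norm_sub_norm_le b a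
      rw [dist_comm, dist_eq_norm]; linarith
    have hab₁ := hab.trans_le (min_le_left _ _)
    have hab₂ := hab.trans_le (min_le_right _ _)
    obtain ⟨c, hc, hbc⟩ := h₂.1 b hb (by linarith)
    have hbc₁ := hbc.trans_le (min_le_left _ _)
    exact ⟨c, hc, by linarith [dist_triangle a b c]⟩
  refine ⟨key h₁ h₂, fun b hb hn => ?_⟩
  obtain ⟨a, ha, hd⟩ := key h₂.symm h₁.symm b hb hn
  exact ⟨a, ha, by rwa [dist_comm]⟩

/-- The entourages `{(A, B) | A and B are ε-close}`, for `ε > 0`. -/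
def localFilterBasis (E : Type) [NormedAddCommGroup E] : FilterBasis (Set E × Set E) where
  sets := {V | ∃ ε : ℝ, 0 < ε ∧ V = {p | LocallyClose ε p.1 p.2}}
  nonempty := ⟨_, 1, one_pos, rfl⟩
  inter_sets := by
    rintro _ _ ⟨ε, hε, rfl⟩ ⟨δ, hδ, rfl⟩
    exact ⟨_, ⟨min ε δ, lt_min hε hδ, rfl⟩, fun p hp =>
      ⟨LocallyClose.mono (lt_min hε hδ) (min_le_left _ _) hp,
        LocallyClose.mono (lt_min hε hδ) (min_le_right _ _) hp⟩⟩

/-- The uniform structure (hence the topology) on the subsets of `E` in which two sets are close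
if their restrictions to a large ball about the origin are close in the Hausdorff distance. -/
instance localUniformSpace : UniformSpace (Set E) :=
  UniformSpace.ofCore <| UniformSpace.Core.mkOfBasis (localFilterBasis E)
    (by
      rintro _ ⟨ε, hε, rfl⟩ A
      exact ⟨fun a ha _ => ⟨a, ha, by simpa using hε⟩, fun a ha _ => ⟨a, ha, by simpa using hε⟩⟩)
    (by
      rintro _ ⟨ε, hε, rfl⟩
      exact ⟨_, ⟨ε, hε, rfl⟩, fun p hp => LocallyClose.symm hp⟩)
    (by
      rintro _ ⟨ε, hε, rfl⟩
      refine ⟨_, ⟨min (ε / 2) ε⁻¹, lt_min (by linarith) (inv_pos.mpr hε), rfl⟩, ?_⟩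
      rintro ⟨A, D⟩ ⟨B, h₁, h₂⟩
      exact LocallyClose.comp hε h₁ h₂)

/-! ### Hull, transversal, maximal equicontinuous factor -/

/-- The translate `Λ - x`. -/
def shift (Λ : Set E) (x : E) : Set E := {y | y + x ∈ Λ}

/-- The continuous hull `Ω_Λ`: the closure of the translation orbit of `Λ`. -/
def hull (Λ : Set E) : Set (Set E) := closure (range fun t : E => shift Λ t)

/-- The canonical transversal `Ξ_Λ`: the closure of `{Λ - x | x ∈ Λ}`. -/
def transversal (Λ : Set E) : Set (Set E) := closure ((fun x : E => shift Λ x) '' Λ)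

/-- `A` and `B` agree exactly on the closed ball of radius `R` about the origin. -/
def AgreeOut (R : ℝ) (A B : Set E) : Prop :=
  A ∩ Metric.closedBall 0 R = B ∩ Metric.closedBall 0 R

/-- `π : Ω_Λ → Y` is a factor map from the hull of `Λ`, with its translation action, onto an
equicontinuous dynamical system `Y`. (Values of `π` off the hull are irrelevant.) -/
structure IsEquicontinuousFactor (Λ : Set E) (Y : Type) [UniformSpace Y] [AddAction E Y]
    (π : Set E → Y) : Prop where
  continuousOn : ContinuousOn π (hull Λ)
  surjOn : SurjOn π (hull Λ) univ
  equivariant : ∀ A ∈ hull Λ, ∀ t : E, π (shift A t) = (-t) +ᵥ π A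
  equicontinuous : Equicontinuous fun (t : E) (y : Y) => t +ᵥ y

/-- The relation `R_max` on the hull of `Λ`: two elements have the same image in the maximal
equicontinuous factor. As every equicontinuous factor is a factor of the maximal one, which is
itself equicontinuous, this says that no equicontinuous factor separates them. -/
def MaxEquicontinuousRel (Λ A B : Set E) : Prop :=
  A ∈ hull Λ ∧ B ∈ hull Λ ∧
    ∀ (Y : Type) [UniformSpace Y] [CompactSpace Y] [T2Space Y] [AddAction E Y]
      [ContinuousVAdd E Y] (π : Set E → Y), IsEquicontinuousFactor Λ Y π → π A = π B

/-! ### Pattern equivariance -/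

/-- `φ : Λ → Y` is strongly pattern equivariant. -/
def IsStronglyPE {Y : Type*} (Λ : Set E) (φ : Λ → Y) : Prop :=
  ∃ R : ℝ, 0 < R ∧ ∀ x₁ x₂ : Λ, AgreeOut R (shift Λ x₁) (shift Λ x₂) → φ x₁ = φ x₂

/-- `G` is a continuous function on the transversal of `Λ` that induces `φ : Λ → Y`.
(Values of `G` off the transversal are irrelevant.) -/
def IsContinuousLift {Y : Type*} [TopologicalSpace Y] (Λ : Set E) (φ : Λ → Y)
    (G : Set E → Y) : Prop :=
  ContinuousOn G (transversal Λ) ∧ ∀ x : Λ, φ x = G (shift Λ x)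

/-- `φ : Λ → Y` is weakly pattern equivariant. -/
def IsWeaklyPE {Y : Type*} [TopologicalSpace Y] (Λ : Set E) (φ : Λ → Y) : Prop :=
  ∃ G : Set E → Y, IsContinuousLift Λ φ G

/-- The weakly pattern equivariant function `φ : Λ → Y` is nonslip, with radius `ε⁻¹`. -/
def IsNonslip {Y : Type*} [TopologicalSpace Y] (Λ : Set E) (φ : Λ → Y) : Prop :=
  ∃ G : Set E → Y, IsContinuousLift Λ φ G ∧ ∃ ε : ℝ, 0 < ε ∧
    ∀ Λ₁ ∈ transversal Λ, ∀ Λ₂ ∈ transversal Λ, MaxEquicontinuousRel Λ Λ₁ Λ₂ →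
      AgreeOut ε⁻¹ Λ₁ Λ₂ → G Λ₁ = G Λ₂

/-- The coboundary of `F : Λ → Y`, that is `(x₁, x₂) ↦ F x₂ - F x₁`, is strongly pattern
equivariant: for each bound `r` on the length there is a radius `R` such that the value on a pair
of points at distance at most `r` is determined, up to translation of the pair, by the pattern of
radius `R` around it. (Any two points at distance at most `r` are joined by a path of boundedly many
edges of a locally derived tiling with vertex set `Λ`, so that it does not matter whether one
takes all such pairs or only the edges of a tiling.) -/
def HasStronglyPECoboundary {Y : Type*} [AddCommGroup Y] (Λ : Set E) (F : Λ → Y) : Prop :=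
  ∀ r : ℝ, ∃ R : ℝ, 0 < R ∧ ∀ x₁ x₂ y₁ y₂ : Λ,
    (x₂ : E) - x₁ = y₂ - y₁ → ‖(x₂ : E) - x₁‖ ≤ r → AgreeOut R (shift Λ x₁) (shift Λ y₁) →
      F x₂ - F x₁ = F y₂ - F y₁

end PointSets

/-! ### Cut and project schemes and model sets -/

/-- A cut and project scheme with internal group `H` and physical space `E`. -/
structure CutProjectScheme (H : Type*) [AddCommGroup H] [TopologicalSpace H]
    (E : Type) [NormedAddCommGroup E] where
  lattice : AddSubgroup (H × E)
  discrete : DiscreteTopology lattice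
  cocompact : CompactSpace ((H × E) ⧸ lattice)
  injective_physical : InjOn Prod.snd (lattice : Set (H × E))
  dense_internal : Dense (Prod.fst '' (lattice : Set (H × E)))

namespace CutProjectScheme

variable {H : Type*} [AddCommGroup H] [TopologicalSpace H] {E : Type} [NormedAddCommGroup E]
  (S : CutProjectScheme H E)

/-- A window is compact, the closure of its interior, and has no nonzero translational period. -/
structure IsWindow (W : Set H) : Prop where
  isCompact : IsCompact W
  closure_interior : closure (interior W) = W
  aperiodic : ∀ h : H, (fun w => w + h) '' W = W → h = 0

/-- The projection set with window `W` and parameter (represented by) `ξ`. -/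
def projectionSet (W : Set H) (ξ : H × E) : Set E :=
  {x | ∃ γ ∈ S.lattice, (γ + ξ).1 ∈ W ∧ (γ + ξ).2 = x}

/-- The parameter `ξ` is non-singular: `π^⊥(Γ + ξ)` does not meet the boundary of `W`. -/
def IsNonsingular (W : Set H) (ξ : H × E) : Prop :=
  ∀ γ ∈ S.lattice, (γ + ξ).1 ∉ frontier W

/-- A model set with window `W`: an element of the hull of a projection set with non-singular
parameter. -/
def IsModelSet (W : Set H) (M : Set E) : Prop :=
  ∃ ξ : H × E, S.IsNonsingular W ξ ∧ M ∈ hull (S.projectionSet W ξ)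

/-- The non-singular model sets with window `W`. -/
def nonsingularModelSets (W : Set H) : Set (Set E) :=
  {A | ∃ ξ : H × E, S.IsNonsingular W ξ ∧ A = S.projectionSet W ξ}

open Classical in
/-- The parameter in `(H × E) / Γ` of a non-singular model set. -/
noncomputable def nonsingularParameter (W : Set H) (A : Set E) : (H × E) ⧸ S.lattice :=
  if h : ∃ ξ : H × E, S.IsNonsingular W ξ ∧ A = S.projectionSet W ξ then
    QuotientAddGroup.mk h.choose
  else 0

/-- The torus parametrization `π_max` of model sets with window `W`: the continuous extension of
the map that sends a non-singular model set to its parameter. -/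
noncomputable def torusParameter (W : Set H) : Set E → (H × E) ⧸ S.lattice :=
  extendFrom (S.nonsingularModelSets W) (S.nonsingularParameter W)

open Classical in
/-- The star map `σ_M` of a model set `M` with window `W`: for `x ∈ M`, the unique `h` such that
`(h, x)` lies in `Γ + ξ`, where `ξ` is the torus parameter of `M`. -/
noncomputable def starMap (W : Set H) (M : Set E) (x : E) : H :=
  if h : ∃ u : H, (QuotientAddGroup.mk (u, x) : (H × E) ⧸ S.lattice) = S.torusParameter W M then
    h.choose
  else 0

/-- The acceptance domain `W_P` of a `B`-patch `P`: the closure of the intersection of the sets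
`Int(W) - x^*`, for `x ∈ P`, and `W^c - x'^*`, for the displacements `x' ∈ B` with
`x'^* ∈ W - W` that are not in `P`. A point `γ` of the lattice is written as `(x^*, x)`. -/
def acceptanceDomain (W : Set H) (B P : Set E) : Set H :=
  closure {w | (∀ γ ∈ S.lattice, γ.2 ∈ P → w + γ.1 ∈ interior W) ∧
    (∀ γ ∈ S.lattice, (∃ u ∈ W, ∃ v ∈ W, γ.1 = u - v) → γ.2 ∈ B → γ.2 ∉ P → w + γ.1 ∉ W)}

end CutProjectScheme

/-- A closed convex set with nonempty interior in `ℝⁿ × C`, where `C` is discrete (so that such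
a set lies in a single copy of `ℝⁿ`). -/
def IsSector {n : ℕ} {C : Type*} [TopologicalSpace C] (K : Set (EuclideanSpace ℝ (Fin n) × C)) :
    Prop :=
  IsClosed K ∧ (interior K).Nonempty ∧
    ∃ (K₀ : Set (EuclideanSpace ℝ (Fin n))) (c : C), Convex ℝ K₀ ∧ K = K₀ ×ˢ {c}

/-- Every acceptance domain of a patch that contains the origin, for the model sets with window
`W`, is a finite union of closed convex sets with nonempty interior. -/
def HasConvexAcceptanceDomains {n : ℕ} {C : Type*} [AddCommGroup C] [TopologicalSpace C]
    {E : Type} [NormedAddCommGroup E] (S : CutProjectScheme (EuclideanSpace ℝ (Fin n) × C) E)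
    (W : Set (EuclideanSpace ℝ (Fin n) × C)) : Prop :=
  ∀ M' : Set E, S.IsModelSet W M' → ∀ B : Set E, IsCompact B → (0 : E) ∈ M' ∩ B →
    ∃ 𝒦 : Set (Set (EuclideanSpace ℝ (Fin n) × C)), 𝒦.Finite ∧ (∀ K ∈ 𝒦, IsSector K) ∧
      S.acceptanceDomain W B (M' ∩ B) = ⋃₀ 𝒦

/-! ### Local topology and locally finite sets -/

section PointSetLemmas

variable {E : Type} [NormedAddCommGroup E]

/-! The idea is to see `F` locally as a continuous function of the star map, and then to let the
rigidity of its coboundary force that function to be affine.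

A pointed element of the hull has a unique internal parameter `w` (`IsStarParameter`), which depends
continuously on it. Two elements with the same `w` are proximal: lattice translations moving `w`
towards a nonsingular value carry both to the same nonsingular model set. No equicontinuous factor
separates them (`IsModelSet.maxEquicontinuousRel`), so the nonslip condition says that, among points
with a fixed patch of radius `ε⁻¹`, the value of `F` depends on `w` alone. Compactness makes this a
continuous function `f` on the acceptance domain of the patch
(`IsModelSet.exists_continuousOn_acceptanceDomain`).

For a fixed displacement the coboundary takes only finitely many values. Along a lattice vector, the
difference of two such local functions is continuous and takes values in a finite set, so it is
constant on open connected sets (`IsModelSet.constant_difference`). The lattice directions are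
dense, so differences of `f` on a sector do not depend on the base point, and `f` is affine there
(`exists_linear_of_translation_invariant_differences`). A lattice vector leading from one sector
into another shows that all linear parts equal a single `L` (`IsModelSet.linear_eq_of_sectors`).

Thus `F - L ∘ σ` has one value for each sector of each patch, so finitely many in all. It also lifts
continuously to the compact transversal, and is therefore strongly pattern equivariant
(`isStronglyPE_of_finite_range`). -/

theorem hasBasis_uniformity_localUniformSpace :
    (uniformity (Set E)).HasBasis (fun ε : ℝ => 0 < ε) fun ε => {p | LocallyClose ε p.1 p.2} := by
  have h := (localFilterBasis E).hasBasis
  refine ⟨fun t => ?_⟩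
  refine (h.mem_iff (t := t)).trans ⟨?_, ?_⟩
  · rintro ⟨_, ⟨ε, hε, rfl⟩, h2⟩
    exact ⟨ε, hε, h2⟩
  · rintro ⟨ε, hε, h2⟩
    exact ⟨_, ⟨ε, hε, rfl⟩, h2⟩

theorem hasBasis_nhds_localUniformSpace (A : Set E) :
    (𝓝 A).HasBasis (fun ε : ℝ => 0 < ε) fun ε => {B | LocallyClose ε A B} :=
  nhds_basis_uniformity' hasBasis_uniformity_localUniformSpace

theorem mem_closure_iff_locallyClose {𝒮 : Set (Set E)} {A : Set E} :
    A ∈ closure 𝒮 ↔ ∀ ε : ℝ, 0 < ε → ∃ B ∈ 𝒮, LocallyClose ε A B := by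
  rw [mem_closure_iff_nhds_basis (hasBasis_nhds_localUniformSpace A)]
  rfl

theorem AgreeOut.mem_iff {R : ℝ} {A B : Set E} (h : AgreeOut R A B) {x : E} (hx : ‖x‖ ≤ R) :
    x ∈ A ↔ x ∈ B := by
  have := Set.ext_iff.1 h x
  simpa [hx] using this

theorem agreeOut_of_forall {R : ℝ} {A B : Set E} (h : ∀ x, ‖x‖ ≤ R → (x ∈ A ↔ x ∈ B)) :
    AgreeOut R A B := by
  ext x
  by_cases hx : ‖x‖ ≤ R <;> simp [hx, h x]

theorem AgreeOut.locallyClose {ε : ℝ} (hε : 0 < ε) {A B : Set E} (h : AgreeOut ε⁻¹ A B) :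
    LocallyClose ε A B :=
  ⟨fun a ha hn => ⟨a, (h.mem_iff hn).1 ha, by simpa⟩,
    fun a ha hn => ⟨a, (h.mem_iff hn).2 ha, by simpa⟩⟩

@[simp] theorem mem_shift {A : Set E} {x y : E} : y ∈ shift A x ↔ y + x ∈ A := Iff.rfl

theorem shift_shift (A : Set E) (s t : E) : shift (shift A s) t = shift A (t + s) := by
  ext y
  simp [add_assoc]

@[simp] theorem shift_zero (A : Set E) : shift A 0 = A := by
  ext y
  simp

/-- Shifting two close sets by close vectors gives close sets. -/
theorem exists_locallyClose_shift (s : E) {ε : ℝ} (hε : 0 < ε) :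
    ∃ δ : ℝ, 0 < δ ∧ ∀ A B t, dist s t < δ → LocallyClose δ A B →
      LocallyClose ε (shift A s) (shift B t) := by
  have hi : 0 < ε⁻¹ := inv_pos.2 hε
  have hK : 0 < ε⁻¹ + ‖s‖ + 1 := by positivity
  -- Half of `ε` pays for moving the points and half for `s ≠ t`. The bound `1` gives `‖t‖ ≤ ‖s‖ +
  -- 1`, and the last term makes the ball of radius `δ⁻¹` contain the shifted ball of radius `ε⁻¹`.
  refine ⟨min (min (ε / 2) 1) (ε⁻¹ + ‖s‖ + 1)⁻¹, by positivity, fun A B t hst h => ?_⟩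
  set δ := min (min (ε / 2) 1) (ε⁻¹ + ‖s‖ + 1)⁻¹ with hδ
  have hδ0 : 0 < δ := by positivity
  have h1 : δ ≤ ε / 2 := (min_le_left _ _).trans (min_le_left _ _)
  have h2 : δ ≤ 1 := (min_le_left _ _).trans (min_le_right _ _)
  have h3 : ε⁻¹ + ‖s‖ + 1 ≤ δ⁻¹ := by
    rw [le_inv_comm₀ hK hδ0]
    exact min_le_right _ _
  have ht : ‖t‖ ≤ ‖s‖ + 1 := by
    have := norm_sub_norm_le t s
    rw [dist_comm, dist_eq_norm] at hst
    linarith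
  constructor
  · intro x hx hn
    obtain ⟨b, hb, hd⟩ := h.1 (x + s) hx (by linarith [norm_add_le x s])
    refine ⟨b - t, by simpa using hb, ?_⟩
    have := dist_triangle (x + s) b (b - t + s)
    rw [← dist_add_right x (b - t) s]
    have h4 : dist b (b - t + s) = dist s t := by
      rw [dist_eq_norm, dist_eq_norm, ← norm_neg]
      congr 1
      abel
    linarith
  · intro y hy hn
    obtain ⟨a, ha, hd⟩ := h.2 (y + t) hy (by linarith [norm_add_le y t])
    refine ⟨a - s, by simpa using ha, ?_⟩
    have := dist_triangle a (y + t) (y + s)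
    rw [← dist_add_right (a - s) y s, sub_add_cancel]
    have h4 : dist (y + t) (y + s) = dist s t := by rw [dist_add_left, dist_comm]
    linarith

theorem continuous_shift (t : E) : Continuous fun A : Set E => shift A t := by
  rw [continuous_iff_continuousAt]
  intro A
  refine ((hasBasis_nhds_localUniformSpace A).tendsto_iff
    (hasBasis_nhds_localUniformSpace (shift A t))).2 fun ε hε => ?_
  obtain ⟨δ, hδ, h⟩ := exists_locallyClose_shift t hε
  exact ⟨δ, hδ, fun B hB => h A B t (by simpa using hδ) hB⟩

theorem self_mem_hull (A : Set E) : A ∈ hull A :=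
  subset_closure ⟨0, by simp⟩

theorem shift_mem_hull {A B : Set E} (h : B ∈ hull A) (t : E) : shift B t ∈ hull A := by
  refine map_mem_closure (f := fun A : Set E => shift A t) (continuous_shift t) h ?_
  rintro _ ⟨s, rfl⟩
  exact ⟨t + s, (shift_shift A s t).symm⟩

theorem hull_subset_hull {A B : Set E} (h : B ∈ hull A) : hull B ⊆ hull A := by
  refine closure_minimal ?_ isClosed_closure
  rintro _ ⟨s, rfl⟩
  exact shift_mem_hull h s

theorem transversal_subset_hull (A : Set E) : transversal A ⊆ hull A := by
  refine closure_mono ?_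
  rintro _ ⟨s, _, rfl⟩
  exact ⟨s, rfl⟩

theorem shift_mem_transversal {A : Set E} {x : E} (hx : x ∈ A) : shift A x ∈ transversal A :=
  subset_closure ⟨x, hx, rfl⟩

/-- A set that meets every ball in a finite set. -/
def IsLocallyFiniteSet (Δ : Set E) : Prop := ∀ R : ℝ, (Δ ∩ Metric.closedBall 0 R).Finite

/-- Points of `Δ` in a ball are uniformly separated, so two of them closer than the separation
coincide. -/
theorem IsLocallyFiniteSet.exists_agreeOut {Δ : Set E} (hΔ : IsLocallyFiniteSet Δ) (R : ℝ) :
    ∃ ε : ℝ, 0 < ε ∧ ∀ A B, A ⊆ Δ → B ⊆ Δ → LocallyClose ε A B → AgreeOut R A B := by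
  -- The extra `1` is needed because the partner of a point of norm at most `R` may lie slightly
  -- outside the ball.
  have hfin := hΔ (R + 1)
  set T := Δ ∩ Metric.closedBall 0 (R + 1)
  obtain ⟨δ, hδ, hsep⟩ : ∃ δ : ℝ, 0 < δ ∧ ∀ x ∈ T, ∀ y ∈ T, dist x y < δ → x = y := by
    by_cases hT : T.Nontrivial
    · refine ⟨T.infsep, hfin.infsep_pos_iff_nontrivial.2 hT, fun x hx y hy h => ?_⟩
      by_contra hne
      exact absurd (infsep_le_dist_of_mem hx hy hne) (not_le.2 h)
    · rw [not_nontrivial_iff] at hT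
      exact ⟨1, one_pos, fun x hx y hy _ => hT hx hy⟩
  have hR : 0 < |R| + 1 := by positivity
  refine ⟨min (min δ 1) (|R| + 1)⁻¹, by positivity, fun A B hA hB h => ?_⟩
  set ε := min (min δ 1) (|R| + 1)⁻¹
  have hε0 : 0 < ε := by positivity
  have h1 : ε ≤ δ := (min_le_left _ _).trans (min_le_left _ _)
  have h2 : ε ≤ 1 := (min_le_left _ _).trans (min_le_right _ _)
  have h3 : |R| + 1 ≤ ε⁻¹ := by
    rw [le_inv_comm₀ hR hε0]
    exact min_le_right _ _
  have key : ∀ A B : Set E, A ⊆ Δ → B ⊆ Δ → LocallyClose ε A B → ∀ x, ‖x‖ ≤ R → x ∈ A → x ∈ B := by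
    intro A B hA hB h x hx hxA
    obtain ⟨b, hb, hd⟩ := h.1 x hxA (by linarith [le_abs_self R])
    have hbn : ‖b‖ ≤ R + 1 := by
      have := norm_sub_norm_le b x
      rw [dist_comm, dist_eq_norm] at hd
      linarith
    have := hsep x ⟨hA hxA, by simpa using by linarith⟩ b ⟨hB hb, by simpa using hbn⟩ (by linarith)
    rwa [this]
  exact agreeOut_of_forall fun x hx => ⟨key A B hA hB h x hx, key B A hB hA h.symm x hx⟩

theorem IsLocallyFiniteSet.isClosed {Δ : Set E} (hΔ : IsLocallyFiniteSet Δ) : IsClosed Δ := by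
  refine isClosed_of_closure_subset fun x hx => ?_
  have h := (hΔ (‖x‖ + 1)).isClosed
  have : x ∈ closure (Δ ∩ Metric.closedBall 0 (‖x‖ + 1)) := by
    refine mem_closure_iff_nhds.2 fun t ht => ?_
    obtain ⟨y, hy, hyΔ⟩ := mem_closure_iff_nhds.1 hx (t ∩ Metric.closedBall x 1)
      (inter_mem ht (Metric.closedBall_mem_nhds x one_pos))
    refine ⟨y, hy.1, hyΔ, ?_⟩
    have h1 := hy.2
    rw [Metric.mem_closedBall, dist_eq_norm] at h1
    have := norm_sub_norm_le y x
    simpa using by linarith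
  exact (h.closure_subset this).1

theorem subset_of_mem_closure {Δ : Set E} (hΔ : IsClosed Δ) {𝒮 : Set (Set E)}
    (h𝒮 : ∀ B ∈ 𝒮, B ⊆ Δ) {A : Set E} (hA : A ∈ closure 𝒮) : A ⊆ Δ := by
  intro a ha
  rw [mem_closure_iff_locallyClose] at hA
  rw [← hΔ.closure_eq, Metric.mem_closure_iff]
  intro ε hε
  have h0 : 0 < min ε (‖a‖ + 1)⁻¹ := by positivity
  obtain ⟨B, hB, hAB⟩ := hA _ h0
  have h3 : ‖a‖ + 1 ≤ (min ε (‖a‖ + 1)⁻¹)⁻¹ := by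
    rw [le_inv_comm₀ (by positivity) h0]
    exact min_le_right _ _
  obtain ⟨b, hb, hd⟩ := hAB.1 a ha (by linarith)
  exact ⟨b, h𝒮 B hB hb, hd.trans_le (min_le_left _ _)⟩

/-- In a family of subsets of a fixed locally finite set, closure means agreement on balls. -/
theorem IsLocallyFiniteSet.exists_agreeOut_of_mem_closure {Δ : Set E} (hΔ : IsLocallyFiniteSet Δ)
    {𝒮 : Set (Set E)} (h𝒮 : ∀ B ∈ 𝒮, B ⊆ Δ) {A : Set E} (hA : A ∈ closure 𝒮) (R : ℝ) :
    ∃ B ∈ 𝒮, AgreeOut R A B := by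
  have hAΔ := subset_of_mem_closure hΔ.isClosed h𝒮 hA
  obtain ⟨ε, hε, h⟩ := hΔ.exists_agreeOut R
  obtain ⟨B, hB, hAB⟩ := mem_closure_iff_locallyClose.1 hA ε hε
  exact ⟨B, hB, h A B hAΔ (h𝒮 B hB) hAB⟩

theorem IsLocallyFiniteSet.finite_patches {Δ : Set E} (hΔ : IsLocallyFiniteSet Δ)
    {𝒮 : Set (Set E)} (h𝒮 : ∀ B ∈ 𝒮, B ⊆ Δ) (R : ℝ) :
    ((fun A => A ∩ Metric.closedBall 0 R) '' 𝒮).Finite := by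
  refine (hΔ R).finite_subsets.subset ?_
  rintro _ ⟨A, hA, rfl⟩
  exact inter_subset_inter_left _ (h𝒮 A hA)

/-- The subsets of `Δ` are the continuous image of the compact space `Δ → Bool`: by local
finiteness, a basic neighbourhood constrains only finitely many coordinates. -/
theorem IsLocallyFiniteSet.isCompact_of_isClosed {Δ : Set E} (hΔ : IsLocallyFiniteSet Δ)
    {𝒮 : Set (Set E)} (h𝒮 : ∀ B ∈ 𝒮, B ⊆ Δ) (hcl : IsClosed 𝒮) : IsCompact 𝒮 := by
  have hcont : Continuous fun χ : Δ → Bool => {x : E | ∃ h : x ∈ Δ, χ ⟨x, h⟩ = true} := by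
    rw [continuous_iff_continuousAt]
    intro χ
    refine ((hasBasis_nhds_localUniformSpace _).tendsto_right_iff).2 fun ε hε => ?_
    have hfin : {x : Δ | ‖(x : E)‖ ≤ ε⁻¹}.Finite := by
      refine Set.Finite.of_finite_image ((hΔ ε⁻¹).subset ?_) Subtype.val_injective.injOn
      rintro _ ⟨x, hx, rfl⟩
      exact ⟨x.2, by simpa using hx⟩
    have hev : ∀ᶠ χ' in 𝓝 χ, ∀ x ∈ {x : Δ | ‖(x : E)‖ ≤ ε⁻¹}, χ' x = χ x := by
      rw [eventually_all_finite hfin]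
      intro x _
      exact (continuous_apply x).continuousAt.preimage_mem_nhds
        ((isOpen_discrete {χ x}).mem_nhds rfl)
    filter_upwards [hev] with χ' hχ'
    refine AgreeOut.locallyClose hε (agreeOut_of_forall fun x hx => ?_)
    refine exists_congr fun h => ?_
    rw [hχ' ⟨x, h⟩ hx]
  have himg : 𝒮 = (fun χ : Δ → Bool => {x : E | ∃ h : x ∈ Δ, χ ⟨x, h⟩ = true}) ''
      ((fun χ : Δ → Bool => {x : E | ∃ h : x ∈ Δ, χ ⟨x, h⟩ = true}) ⁻¹' 𝒮) := by
    refine (image_preimage_eq_of_subset ?_).symm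
    intro A hA
    classical
    refine ⟨fun x => decide ((x : E) ∈ A), ?_⟩
    ext x
    simpa using fun h => h𝒮 A hA h
  rw [himg]
  exact (hcl.preimage hcont).isCompact.image hcont

end PointSetLemmas

/-! ### Star parameters of point sets -/

namespace CutProjectScheme

variable {H : Type*} [AddCommGroup H] [TopologicalSpace H] {E : Type} [NormedAddCommGroup E]
  (S : CutProjectScheme H E)

theorem isClosed_lattice [IsTopologicalAddGroup H] [T2Space H] :
    IsClosed (S.lattice : Set (H × E)) := by
  have := S.discrete
  exact AddSubgroup.isClosed_of_discrete

theorem finite_lattice_inter [IsTopologicalAddGroup H] [T2Space H] [ProperSpace E]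
    {K : Set H} (hK : IsCompact K) (R : ℝ) :
    {γ : H × E | γ ∈ S.lattice ∧ γ.1 ∈ K ∧ ‖γ.2‖ ≤ R}.Finite := by
  have h : IsCompact ((S.lattice : Set (H × E)) ∩ K ×ˢ Metric.closedBall 0 R) :=
    (hK.prod (isCompact_closedBall 0 R)).inter_left S.isClosed_lattice
  have hd : IsDiscrete (S.lattice : Set (H × E)) := ⟨S.discrete⟩
  refine (h.finite (hd.mono inter_subset_left)).subset ?_
  rintro γ ⟨h1, h2, h3⟩
  exact ⟨h1, h2, by simpa using h3⟩

theorem eq_of_snd_eq {γ γ' : H × E} (h : γ ∈ S.lattice) (h' : γ' ∈ S.lattice) (he : γ.2 = γ'.2) :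
    γ = γ' :=
  S.injective_physical h h' he

/-- The physical components of the lattice points whose internal component lies in `W - W`. -/
def displacements (W : Set H) : Set E :=
  {x | ∃ γ ∈ S.lattice, (∃ u ∈ W, ∃ v ∈ W, γ.1 = u - v) ∧ γ.2 = x}

theorem isLocallyFiniteSet_displacements [IsTopologicalAddGroup H] [T2Space H] [ProperSpace E]
    {W : Set H} (hW : IsCompact W) : IsLocallyFiniteSet (S.displacements W) := by
  intro R
  have hK : IsCompact ((fun p : H × H => p.1 - p.2) '' W ×ˢ W) :=
    (hW.prod hW).image (by fun_prop)
  refine ((S.finite_lattice_inter hK R).image Prod.snd).subset ?_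
  rintro _ ⟨⟨γ, hγ, ⟨u, hu, v, hv, huv⟩, rfl⟩, hR⟩
  exact ⟨γ, ⟨hγ, ⟨(u, v), ⟨hu, hv⟩, huv.symm⟩, by simpa using hR⟩, rfl⟩

/-- `A` lies between the projection sets of the interior of `W` and of `W`, both with parameter
`(w, 0)`. -/
structure IsStarParameter (W : Set H) (w : H) (A : Set E) : Prop where
  mem_of_interior : ∀ γ ∈ S.lattice, w + γ.1 ∈ interior W → γ.2 ∈ A
  exists_lattice : ∀ a ∈ A, ∃ γ ∈ S.lattice, γ.2 = a ∧ w + γ.1 ∈ W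

variable {S} {W : Set H} {w : H} {A : Set E}

theorem IsStarParameter.mem_window_of_mem (h : S.IsStarParameter W w A) {γ : H × E}
    (hγ : γ ∈ S.lattice) (hA : γ.2 ∈ A) : w + γ.1 ∈ W := by
  obtain ⟨γ', hγ', he, hw⟩ := h.exists_lattice _ hA
  rwa [S.eq_of_snd_eq hγ hγ' he.symm]

theorem IsStarParameter.mem_window (h : S.IsStarParameter W w A) (h0 : (0 : E) ∈ A) : w ∈ W := by
  simpa using h.mem_window_of_mem (γ := 0) S.lattice.zero_mem h0

theorem IsStarParameter.subset_displacements (h : S.IsStarParameter W w A) (h0 : (0 : E) ∈ A) :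
    A ⊆ S.displacements W := by
  intro a ha
  obtain ⟨γ, hγ, he, hw⟩ := h.exists_lattice a ha
  exact ⟨γ, hγ, ⟨_, hw, _, h.mem_window h0, by abel⟩, he⟩

theorem IsStarParameter.shift (h : S.IsStarParameter W w A) {γ : H × E} (hγ : γ ∈ S.lattice) :
    S.IsStarParameter W (w + γ.1) (shift A γ.2) where
  mem_of_interior β hβ hw := by
    have := h.mem_of_interior (β + γ) (S.lattice.add_mem hβ hγ)
      (by rwa [Prod.fst_add, add_comm β.1, ← add_assoc])
    simpa using this
  exists_lattice a ha := by
    obtain ⟨β, hβ, he, hw⟩ := h.exists_lattice _ ha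
    refine ⟨β - γ, S.lattice.sub_mem hβ hγ, by simp [he], ?_⟩
    rwa [Prod.fst_sub, add_assoc, add_sub_cancel]

theorem isStarParameter_projectionSet (ξ : H × E) {γ : H × E} (hγ : γ ∈ S.lattice) :
    S.IsStarParameter W (γ + ξ).1 (_root_.shift (S.projectionSet W ξ) (γ + ξ).2) where
  mem_of_interior β hβ hw := by
    refine ⟨β + γ, S.lattice.add_mem hβ hγ, ?_, ?_⟩
    · convert interior_subset hw using 1
      simp only [Prod.fst_add]
      abel
    · simp only [Prod.snd_add]
      abel
  exists_lattice a ha := by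
    obtain ⟨β, hβ, hw, he⟩ := ha
    refine ⟨β - γ, S.lattice.sub_mem hβ hγ, ?_, ?_⟩
    · rw [Prod.snd_sub, ← add_left_inj (γ + ξ).2, ← he]
      simp only [Prod.snd_add]
      abel
    · convert hw using 1
      simp only [Prod.fst_add, Prod.fst_sub]
      abel

/-! ### Uniqueness and limits of star parameters -/

section Limits

variable [IsTopologicalAddGroup H]

theorem dense_translate_internal (S : CutProjectScheme H E) (w : H) :
    Dense ((fun γ : H × E => w + γ.1) '' (S.lattice : Set (H × E))) := by
  have := (Homeomorph.addLeft w).surjective.denseRange.dense_image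
    (Homeomorph.addLeft w).continuous S.dense_internal
  rwa [image_image] at this

theorem exists_lattice_mem_of_isOpen (S : CutProjectScheme H E) (w : H) {U : Set H}
    (hU : IsOpen U) (hne : U.Nonempty) : ∃ γ ∈ S.lattice, w + γ.1 ∈ U := by
  obtain ⟨_, hx, γ, hγ, rfl⟩ := (S.dense_translate_internal w).inter_open_nonempty U hU hne
  exact ⟨γ, hγ, hx⟩

/-- The window is recovered from `A` and `w`: the lattice values are dense in `interior W`, whose
closure is `W`, so what happens on the boundary is irrelevant. -/
theorem IsStarParameter.closure_eq [T2Space H] (hW : IsWindow W) (h : S.IsStarParameter W w A) :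
    closure ((fun γ : H × E => w + γ.1) '' {γ | γ ∈ S.lattice ∧ γ.2 ∈ A}) = W := by
  refine Subset.antisymm (closure_minimal ?_ hW.isCompact.isClosed) ?_
  · rintro _ ⟨γ, ⟨hγ, hA⟩, rfl⟩
    exact h.mem_window_of_mem hγ hA
  · conv_lhs => rw [← hW.closure_interior]
    refine (closure_minimal ((S.dense_translate_internal w).open_subset_closure_inter
      isOpen_interior) isClosed_closure).trans (closure_mono ?_)
    rintro _ ⟨hw, γ, hγ, rfl⟩
    exact ⟨γ, ⟨hγ, h.mem_of_interior γ hγ hw⟩, rfl⟩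

/-- Recovering `W` from each parameter shows that `w' - w` is a period of `W`, and aperiodicity
applies. -/
theorem IsStarParameter.unique [T2Space H] (hW : IsWindow W) {w' : H}
    (h : S.IsStarParameter W w A) (h' : S.IsStarParameter W w' A) : w = w' := by
  refine (sub_eq_zero.1 (hW.aperiodic (w' - w) ?_)).symm
  conv_lhs => rw [← h.closure_eq hW]
  rw [← h'.closure_eq hW]
  have := (Homeomorph.addRight (w' - w)).image_closure
    ((fun γ : H × E => w + γ.1) '' {γ | γ ∈ S.lattice ∧ γ.2 ∈ A})
  rw [image_image] at this
  refine this.trans (congrArg closure (image_congr fun γ _ => ?_))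
  change w + γ.1 + (w' - w) = w' + γ.1
  abel

theorem isStarParameter_of_tendsto [T2Space H] (hW : IsCompact W) {ι : Type*} {l : Filter ι}
    [l.NeBot] {B : ι → Set E} {v : ι → H} (hv : Tendsto v l (𝓝 w))
    (hB : ∀ R, ∀ᶠ i in l, AgreeOut R A (B i))
    (h : ∀ᶠ i in l, S.IsStarParameter W (v i) (B i)) : S.IsStarParameter W w A where
  mem_of_interior γ hγ hw := by
    have h1 : ∀ᶠ i in l, v i + γ.1 ∈ interior W :=
      (hv.add_const γ.1).eventually (isOpen_interior.mem_nhds hw)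
    obtain ⟨i, hi1, hi2, hi3⟩ := (h1.and ((hB ‖γ.2‖).and h)).exists
    exact (hi2.mem_iff le_rfl).2 (hi3.mem_of_interior γ hγ hi1)
  exists_lattice a ha := by
    obtain ⟨i, hi, hi'⟩ := ((hB ‖a‖).and h).exists
    obtain ⟨γ, hγ, rfl, -⟩ := hi'.exists_lattice a ((hi.mem_iff le_rfl).1 ha)
    refine ⟨γ, hγ, rfl, hW.isClosed.mem_of_tendsto (hv.add_const γ.1) ?_⟩
    filter_upwards [hB ‖γ.2‖, h] with j hj hj'
    exact hj'.mem_window_of_mem hγ ((hj.mem_iff le_rfl).1 ha)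

/-- The parameters stay in the compact set `W`, and each cluster point is a parameter of `A`, hence
equal to `w`. -/
theorem tendsto_of_isStarParameter [T2Space H] (hW : IsWindow W) {ι : Type*} {l : Filter ι}
    {B : ι → Set E} {v : ι → H} (hB : ∀ R, ∀ᶠ i in l, AgreeOut R A (B i))
    (h0 : (0 : E) ∈ A) (h : ∀ᶠ i in l, S.IsStarParameter W (v i) (B i))
    (hA : S.IsStarParameter W w A) : Tendsto v l (𝓝 w) := by
  have hvW : ∀ᶠ i in l, v i ∈ W := by
    filter_upwards [hB 0, h] with i hi hi'
    exact hi'.mem_window ((hi.mem_iff (by simp)).1 h0)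
  refine hW.isCompact.tendsto_nhds_of_unique_mapClusterPt hvW fun w' _ hcl => ?_
  obtain ⟨u, hu, hut⟩ := mapClusterPt_iff_ultrafilter.1 hcl
  exact (isStarParameter_of_tendsto hW.isCompact hut (fun R => hu (hB R)) (hu h)).unique hW hA

theorem exists_isStarParameter [T2Space H] (hW : IsWindow W) {ι : Type*} {l : Filter ι} [l.NeBot]
    {B : ι → Set E} {v : ι → H} (hB : ∀ R, ∀ᶠ i in l, AgreeOut R A (B i))
    (h0 : (0 : E) ∈ A) (h : ∀ᶠ i in l, S.IsStarParameter W (v i) (B i)) :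
    ∃ w, S.IsStarParameter W w A := by
  have hvW : ∀ᶠ i in l, v i ∈ W := by
    filter_upwards [hB 0, h] with i hi hi'
    exact hi'.mem_window ((hi.mem_iff (by simp)).1 h0)
  obtain ⟨w, -, hcl⟩ := hW.isCompact.exists_mapClusterPt (tendsto_principal.2 hvW)
  obtain ⟨u, hu, hut⟩ := mapClusterPt_iff_ultrafilter.1 hcl
  exact ⟨w, isStarParameter_of_tendsto hW.isCompact hut (fun R => hu (hB R)) (hu h)⟩

end Limits
end CutProjectScheme

/-! ### Recentring approximants at nearby points -/

section Recentering
variable {E : Type} [NormedAddCommGroup E]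

/-- The pointed sets `(A, a)`, with `A ∈ 𝒮` tending to `M` and `a ∈ A` tending to `m`. -/
def pointedFilter (𝒮 : Set (Set E)) (M : Set E) (m : E) : Filter (Set E × E) :=
  (𝓝[𝒮] M ×ˢ 𝓝 m) ⊓ 𝓟 {p | p.2 ∈ p.1}

/-- Every set close to `M` has a point close to `m`, so forgetting the base point loses no
approximant. -/
theorem eventually_of_eventually_pointedFilter {𝒮 : Set (Set E)} {M : Set E} {m : E} (hm : m ∈ M)
    {Q : Set E → Prop} (h : ∀ᶠ p in pointedFilter 𝒮 M m, Q p.1) : ∀ᶠ A in 𝓝[𝒮] M, Q A := by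
  rw [pointedFilter, eventually_inf_principal, eventually_prod_iff] at h
  obtain ⟨P, hP, P', hP', h⟩ := h
  obtain ⟨ε, hε, hball⟩ := Metric.eventually_nhds_iff.1 hP'
  have hpos : 0 < min ε (‖m‖ + 1)⁻¹ := by positivity
  have hle : ‖m‖ + 1 ≤ (min ε (‖m‖ + 1)⁻¹)⁻¹ := by
    rw [le_inv_comm₀ (by positivity) hpos]
    exact min_le_right _ _
  have hclose : ∀ᶠ A in 𝓝[𝒮] M, LocallyClose (min ε (‖m‖ + 1)⁻¹) M A :=
    nhdsWithin_le_nhds ((hasBasis_nhds_localUniformSpace M).mem_of_mem hpos)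
  filter_upwards [hP, hclose] with A hA hc
  obtain ⟨a, ha, hd⟩ := hc.1 m hm (by linarith)
  exact h hA (hball (by rw [dist_comm]; exact hd.trans_le (min_le_left _ _))) ha

theorem pointedFilter_neBot {𝒮 : Set (Set E)} {M : Set E} {m : E} (hm : m ∈ M)
    (hM : M ∈ closure 𝒮) : (pointedFilter 𝒮 M m).NeBot := by
  have := mem_closure_iff_nhdsWithin_neBot.1 hM
  rw [neBot_iff]
  intro hbot
  have := eventually_of_eventually_pointedFilter (𝒮 := 𝒮) (Q := fun _ => False) hm (by simp [hbot])
  simpa using this.exists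

theorem eventually_pointedFilter_mem {𝒮 : Set (Set E)} {M : Set E} {m : E} :
    ∀ᶠ p in pointedFilter 𝒮 M m, p.1 ∈ 𝒮 ∧ p.2 ∈ p.1 := by
  rw [pointedFilter, eventually_inf_principal]
  filter_upwards [(eventually_mem_nhdsWithin (a := M) (s := 𝒮)).prod_inl (𝓝 m)] with p hp hp'
  exact ⟨hp, hp'⟩

theorem tendsto_snd_pointedFilter {𝒮 : Set (Set E)} {M : Set E} {m : E} :
    Tendsto Prod.snd (pointedFilter 𝒮 M m) (𝓝 m) :=
  tendsto_snd.mono_left inf_le_left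

theorem eventually_pointedFilter_locallyClose {𝒮 : Set (Set E)} {M : Set E} {m : E} {ε : ℝ}
    (hε : 0 < ε) :
    ∀ᶠ p in pointedFilter 𝒮 M m, LocallyClose ε (shift M m) (shift p.1 p.2) := by
  obtain ⟨δ, hδ, h⟩ := exists_locallyClose_shift m hε
  have h1 : ∀ᶠ A in 𝓝[𝒮] M, LocallyClose δ M A :=
    nhdsWithin_le_nhds ((hasBasis_nhds_localUniformSpace M).mem_of_mem hδ)
  have h2 : ∀ᶠ a in 𝓝 m, dist m a < δ := by
    filter_upwards [Metric.ball_mem_nhds m hδ] with a ha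
    rwa [dist_comm]
  refine Eventually.filter_mono inf_le_left ?_
  filter_upwards [h1.prod_mk h2] with p hp
  exact h M p.1 p.2 hp.2 hp.1

theorem tendsto_shift_pointedFilter {𝒮 : Set (Set E)} {M : Set E} {m : E} :
    Tendsto (fun p : Set E × E => shift p.1 p.2) (pointedFilter 𝒮 M m) (𝓝 (shift M m)) :=
  (hasBasis_nhds_localUniformSpace _).tendsto_right_iff.2 fun _ hε =>
    eventually_pointedFilter_locallyClose hε

theorem subset_of_pointedFilter {𝒮 : Set (Set E)} {M Δ : Set E} {m : E} (hm : m ∈ M)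
    (hM : M ∈ closure 𝒮) (hΔ : IsClosed Δ) (h : ∀ A ∈ 𝒮, ∀ a ∈ A, shift A a ⊆ Δ) :
    shift M m ⊆ Δ := by
  have := pointedFilter_neBot hm hM
  refine subset_of_mem_closure (𝒮 := {B | B ⊆ Δ}) hΔ (fun B hB => hB)
    (mem_closure_of_tendsto (tendsto_shift_pointedFilter (𝒮 := 𝒮)) ?_)
  filter_upwards [eventually_pointedFilter_mem] with p hp
  exact h _ hp.1 _ hp.2

/-- The approximants need not lie in a common locally finite set, but after recentring they do, and
closeness becomes exact agreement. -/
theorem eventually_pointedFilter_agreeOut {𝒮 : Set (Set E)} {M Δ : Set E} {m : E} (hm : m ∈ M)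
    (hM : M ∈ closure 𝒮) (hΔ : IsLocallyFiniteSet Δ) (h : ∀ A ∈ 𝒮, ∀ a ∈ A, shift A a ⊆ Δ)
    (R : ℝ) : ∀ᶠ p in pointedFilter 𝒮 M m, AgreeOut R (shift M m) (shift p.1 p.2) := by
  obtain ⟨ε, hε, hagree⟩ := hΔ.exists_agreeOut R
  filter_upwards [eventually_pointedFilter_mem, eventually_pointedFilter_locallyClose hε]
    with p hp hp'
  exact hagree _ _ (subset_of_pointedFilter hm hM hΔ.isClosed h) (h _ hp.1 _ hp.2) hp'

end Recentering

/-! ### Torus parameter and star map of a model set -/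

namespace CutProjectScheme

variable {H : Type*} [AddCommGroup H] [TopologicalSpace H] {E : Type} [NormedAddCommGroup E]
  {S : CutProjectScheme H E} {W : Set H}

theorem shift_projectionSet (ξ : H × E) (t : E) :
    _root_.shift (S.projectionSet W ξ) t = S.projectionSet W (ξ - (0, t)) := by
  ext x
  refine exists_congr fun γ => and_congr_right fun _ => and_congr (by simp) ?_
  simp only [Prod.snd_add, Prod.snd_sub]
  rw [← add_sub_assoc, sub_eq_iff_eq_add]

theorem IsNonsingular.shift {ξ : H × E} (h : S.IsNonsingular W ξ) (t : E) :
    S.IsNonsingular W (ξ - (0, t)) := by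
  intro γ hγ
  simpa using h γ hγ

theorem hull_subset_closure_nonsingularModelSets {ξ : H × E} (h : S.IsNonsingular W ξ) :
    hull (S.projectionSet W ξ) ⊆ closure (S.nonsingularModelSets W) := by
  refine closure_mono ?_
  rintro _ ⟨t, rfl⟩
  exact ⟨_, h.shift t, S.shift_projectionSet ξ t⟩

theorem IsModelSet.mem_closure {M : Set E} (h : S.IsModelSet W M) :
    M ∈ closure (S.nonsingularModelSets W) := by
  obtain ⟨ξ, hξ, hM⟩ := h
  exact hull_subset_closure_nonsingularModelSets hξ hM

theorem IsModelSet.of_mem_hull {M A : Set E} (h : S.IsModelSet W M) (hA : A ∈ hull M) :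
    S.IsModelSet W A := by
  obtain ⟨ξ, hξ, hM⟩ := h
  exact ⟨ξ, hξ, hull_subset_hull hM hA⟩

theorem exists_isStarParameter_of_nonsingular {A : Set E} (hA : A ∈ S.nonsingularModelSets W)
    {a : E} (ha : a ∈ A) :
    ∃ w, S.IsStarParameter W w (_root_.shift A a) ∧
      (QuotientAddGroup.mk (w, a) : (H × E) ⧸ S.lattice) = S.nonsingularParameter W A ∧
      ∀ γ ∈ S.lattice, w + γ.1 ∉ frontier W := by
  have hA' : ∃ ξ : H × E, S.IsNonsingular W ξ ∧ A = S.projectionSet W ξ := hA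
  have hpar : S.nonsingularParameter W A = QuotientAddGroup.mk hA'.choose := dif_pos hA'
  obtain ⟨hns, hAe⟩ := hA'.choose_spec
  rw [hpar]
  set ξ := hA'.choose
  rw [hAe] at ha
  obtain ⟨γ, hγ, hw, rfl⟩ := ha
  refine ⟨(γ + ξ).1, ?_, ?_, fun β hβ => ?_⟩
  · rw [hAe]
    exact isStarParameter_projectionSet ξ hγ
  · rw [eq_comm, QuotientAddGroup.eq]
    change -ξ + (γ + ξ) ∈ S.lattice
    rwa [add_comm γ, neg_add_cancel_left]
  · have := hns (β + γ) (S.lattice.add_mem hβ hγ)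
    convert this using 2
    simp only [Prod.fst_add]
    abel

theorem shift_subset_displacements_of_nonsingular {A : Set E} (hA : A ∈ S.nonsingularModelSets W)
    {a : E} (ha : a ∈ A) : _root_.shift A a ⊆ S.displacements W := by
  obtain ⟨w, hw, -⟩ := exists_isStarParameter_of_nonsingular hA ha
  exact hw.subset_displacements (by simpa)

section ModelSets
variable [IsTopologicalAddGroup H] [T2Space H] [ProperSpace E] {M : Set E} {x : E}

/-- A point of a model set is approximated by points of nonsingular model sets, whose parameters
converge. -/
theorem IsModelSet.exists_tendsto (hW : IsWindow W) (hM : S.IsModelSet W M) (hx : x ∈ M) :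
    ∃ w, S.IsStarParameter W w (_root_.shift M x) ∧ ∃ v : Set E × E → H,
      Tendsto v (pointedFilter (S.nonsingularModelSets W) M x) (𝓝 w) ∧
      (∀ R, ∀ᶠ p in pointedFilter (S.nonsingularModelSets W) M x,
        AgreeOut R (_root_.shift M x) (_root_.shift p.1 p.2)) ∧
      ∀ᶠ p in pointedFilter (S.nonsingularModelSets W) M x,
        S.IsStarParameter W (v p) (_root_.shift p.1 p.2) ∧
        (QuotientAddGroup.mk (v p, p.2) : (H × E) ⧸ S.lattice) = S.nonsingularParameter W p.1 ∧
        ∀ γ ∈ S.lattice, v p + γ.1 ∉ frontier W := by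
  have hne := pointedFilter_neBot hx hM.mem_closure
  have hag := eventually_pointedFilter_agreeOut hx hM.mem_closure
    (S.isLocallyFiniteSet_displacements hW.isCompact)
    (fun A hA a ha => shift_subset_displacements_of_nonsingular hA ha)
  have hv : ∀ p : Set E × E, ∃ w, p.1 ∈ S.nonsingularModelSets W ∧ p.2 ∈ p.1 →
      S.IsStarParameter W w (_root_.shift p.1 p.2) ∧
      (QuotientAddGroup.mk (w, p.2) : (H × E) ⧸ S.lattice) = S.nonsingularParameter W p.1 ∧
      ∀ γ ∈ S.lattice, w + γ.1 ∉ frontier W := by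
    intro p
    by_cases hp : p.1 ∈ S.nonsingularModelSets W ∧ p.2 ∈ p.1
    · obtain ⟨w, hw⟩ := exists_isStarParameter_of_nonsingular hp.1 hp.2
      exact ⟨w, fun _ => hw⟩
    · exact ⟨0, fun h => absurd h hp⟩
  choose v hv using hv
  have hev : ∀ᶠ p in pointedFilter (S.nonsingularModelSets W) M x, _ :=
    eventually_pointedFilter_mem.mono hv
  have hst := hev.mono fun p hp => hp.1
  obtain ⟨w, hw⟩ := exists_isStarParameter hW hag (by simpa) hst
  exact ⟨w, hw, v, tendsto_of_isStarParameter hW hag (by simpa) hst hw, hag, hev⟩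

theorem IsModelSet.torusParameter_eq (hW : IsWindow W) (hM : S.IsModelSet W M) (hx : x ∈ M)
    {w : H} (hw : S.IsStarParameter W w (_root_.shift M x)) :
    S.torusParameter W M = QuotientAddGroup.mk (w, x) := by
  obtain ⟨w', hw', v, hv, -, hev⟩ := hM.exists_tendsto hW hx
  obtain rfl := hw'.unique hW hw
  have : IsClosed (S.lattice : Set (H × E)) := S.isClosed_lattice
  refine extendFrom_eq hM.mem_closure (tendsto_def.2 fun U hU => ?_)
  refine eventually_of_eventually_pointedFilter hx
    (Q := fun A => S.nonsingularParameter W A ∈ U) ?_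
  have ht : Tendsto (fun p : Set E × E => (QuotientAddGroup.mk (v p, p.2) : (H × E) ⧸ S.lattice))
      (pointedFilter (S.nonsingularModelSets W) M x) (𝓝 (QuotientAddGroup.mk (w', x))) :=
    (QuotientAddGroup.continuous_mk.tendsto _).comp (hv.prodMk_nhds tendsto_snd_pointedFilter)
  filter_upwards [ht hU, hev] with p hp hp'
  rw [← hp'.2.1]
  exact hp

theorem IsModelSet.isStarParameter_starMap (hW : IsWindow W) (hM : S.IsModelSet W M)
    (hx : x ∈ M) : S.IsStarParameter W (S.starMap W M x) (_root_.shift M x) := by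
  obtain ⟨w, hw, -⟩ := hM.exists_tendsto hW hx
  have hT := hM.torusParameter_eq hW hx hw
  have hex : ∃ u : H, (QuotientAddGroup.mk (u, x) : (H × E) ⧸ S.lattice) =
    S.torusParameter W M := ⟨w, hT.symm⟩
  have hstar : S.starMap W M x = hex.choose := dif_pos hex
  have h := hex.choose_spec.trans hT
  rw [QuotientAddGroup.eq] at h
  -- Two solutions differ by a lattice element with physical part `0`, which vanishes by
  -- injectivity.
  have h0 := S.eq_of_snd_eq h S.lattice.zero_mem (by simp)
  rw [hstar, show hex.choose = w from ?_]
  · exact hw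
  · have := congrArg Prod.fst h0
    simpa [neg_add_eq_zero] using this

end ModelSets
end CutProjectScheme

/-! ### The transversal and proximality -/

namespace CutProjectScheme

variable {H : Type*} [AddCommGroup H] [TopologicalSpace H] {E : Type} [NormedAddCommGroup E]
  {S : CutProjectScheme H E} {W : Set H} [IsTopologicalAddGroup H] [T2Space H] [ProperSpace E]
  {M : Set E}

theorem IsModelSet.shift_subset_displacements (hW : IsWindow W) (hM : S.IsModelSet W M) {x : E}
    (hx : x ∈ M) : _root_.shift M x ⊆ S.displacements W :=
  (hM.isStarParameter_starMap hW hx).subset_displacements (by simpa)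

theorem IsModelSet.subset_displacements_of_mem_transversal (hW : IsWindow W)
    (hM : S.IsModelSet W M) {A : Set E} (hA : A ∈ transversal M) : A ⊆ S.displacements W := by
  refine subset_of_mem_closure (S.isLocallyFiniteSet_displacements hW.isCompact).isClosed ?_ hA
  rintro _ ⟨x, hx, rfl⟩
  exact hM.shift_subset_displacements hW hx

theorem IsModelSet.zero_mem_of_mem_transversal (hW : IsWindow W) (hM : S.IsModelSet W M)
    {A : Set E} (hA : A ∈ transversal M) : (0 : E) ∈ A := by
  obtain ⟨_, ⟨x, hx, rfl⟩, h⟩ := (S.isLocallyFiniteSet_displacements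
    hW.isCompact).exists_agreeOut_of_mem_closure (𝒮 := (fun x : E => _root_.shift M x) '' M)
    (by rintro _ ⟨x, hx, rfl⟩; exact hM.shift_subset_displacements hW hx) hA 0
  exact (h.mem_iff (by simp)).2 (by simpa)

theorem IsModelSet.isCompact_transversal (hW : IsWindow W) (hM : S.IsModelSet W M) :
    IsCompact (transversal M) :=
  (S.isLocallyFiniteSet_displacements hW.isCompact).isCompact_of_isClosed
    (fun _ hA => hM.subset_displacements_of_mem_transversal hW hA) isClosed_closure

theorem IsModelSet.isStarParameter_of_mem_transversal (hW : IsWindow W) (hM : S.IsModelSet W M)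
    {A : Set E} (hA : A ∈ transversal M) : S.IsStarParameter W (S.starMap W A 0) A := by
  simpa using (hM.of_mem_hull (transversal_subset_hull M hA)).isStarParameter_starMap hW
    (hM.zero_mem_of_mem_transversal hW hA)

theorem IsModelSet.eventually_agreeOut (hW : IsWindow W) (hM : S.IsModelSet W M)
    {A : Set E} (hA : A ∈ transversal M) (R : ℝ) :
    ∀ᶠ B in 𝓝[transversal M] A, AgreeOut R A B := by
  obtain ⟨ε, hε, h⟩ := (S.isLocallyFiniteSet_displacements hW.isCompact).exists_agreeOut R
  filter_upwards [self_mem_nhdsWithin,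
    nhdsWithin_le_nhds ((hasBasis_nhds_localUniformSpace A).mem_of_mem hε)] with B hB hAB
  exact h A B (hM.subset_displacements_of_mem_transversal hW hA)
    (hM.subset_displacements_of_mem_transversal hW hB) hAB

/-- The parameter of a pointed model set depends continuously on it. -/
theorem IsModelSet.continuousOn_starMap_zero (hW : IsWindow W) (hM : S.IsModelSet W M) :
    ContinuousOn (fun A => S.starMap W A 0) (transversal M) := by
  intro A hA
  refine tendsto_of_isStarParameter (B := id) hW (hM.eventually_agreeOut hW hA)
    (hM.zero_mem_of_mem_transversal hW hA) ?_ (hM.isStarParameter_of_mem_transversal hW hA)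
  filter_upwards [self_mem_nhdsWithin] with B hB
  exact hM.isStarParameter_of_mem_transversal hW hB

theorem IsModelSet.starMap_shift_zero (hW : IsWindow W) (hM : S.IsModelSet W M) {x : E}
    (hx : x ∈ M) : S.starMap W (_root_.shift M x) 0 = S.starMap W M x :=
  (hM.isStarParameter_of_mem_transversal hW (shift_mem_transversal hx)).unique hW
    (hM.isStarParameter_starMap hW hx)

theorem IsModelSet.starMap_add (hW : IsWindow W) (hM : S.IsModelSet W M) {x : E}
    (hx : x ∈ M) {γ : H × E} (hγ : γ ∈ S.lattice) (hxγ : x + γ.2 ∈ M) :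
    S.starMap W M (x + γ.2) = S.starMap W M x + γ.1 := by
  have h := (hM.isStarParameter_starMap hW hx).shift hγ
  rw [shift_shift, add_comm γ.2] at h
  exact (hM.isStarParameter_starMap hW hxγ).unique hW h

/-- Along lattice translations that move the parameter to a nonsingular value, a point set tends to
the nonsingular model set. -/
theorem IsStarParameter.tendsto_shift [LocallyCompactSpace H] (hW : IsCompact W) {w g : H}
    (hg : S.IsNonsingular W (g, 0)) {A : Set E} (hA : S.IsStarParameter W w A) :
    Tendsto (fun γ : H × E => _root_.shift A γ.2)
      (comap (fun γ : H × E => w + γ.1) (𝓝 g) ⊓ 𝓟 (S.lattice : Set (H × E)))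
      (𝓝 (S.projectionSet W (g, 0))) := by
  refine (hasBasis_nhds_localUniformSpace _).tendsto_right_iff.2 fun ε hε => ?_
  -- For parameters in `K`, only lattice points with internal part in `W - K` can matter in the
  -- ball, and these form the finite set `T`. Nonsingularity of `g` keeps their translates by `g`
  -- off the frontier, so membership is stable near `g`.
  obtain ⟨K, hK, hgK⟩ := exists_compact_mem_nhds g
  have hWK : IsCompact ((fun p : H × H => p.1 - p.2) '' W ×ˢ K) :=
    (hW.prod hK).image (by fun_prop)
  have hfin := S.finite_lattice_inter hWK ε⁻¹
  set T := {γ : H × E | γ ∈ S.lattice ∧ γ.1 ∈ (fun p : H × H => p.1 - p.2) '' W ×ˢ K ∧ ‖γ.2‖ ≤ ε⁻¹}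
  have hev : ∀ᶠ u in 𝓝 g, u ∈ K ∧ ∀ β ∈ T,
      (g + β.1 ∈ W → u + β.1 ∈ interior W) ∧ (g + β.1 ∉ W → u + β.1 ∉ W) := by
    refine (show ∀ᶠ u in 𝓝 g, u ∈ K from hgK).and ((eventually_all_finite hfin).2 fun β hβ => ?_)
    have hc : Tendsto (fun u : H => u + β.1) (𝓝 g) (𝓝 (g + β.1)) :=
      (continuous_add_const β.1).tendsto g
    by_cases hgW : g + β.1 ∈ W
    · have hint : g + β.1 ∈ interior W := by
        by_contra hni
        have := hg β hβ.1
        rw [Prod.fst_add, add_comm] at this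
        exact this ⟨subset_closure hgW, hni⟩
      filter_upwards [hc (isOpen_interior.mem_nhds hint)] with u hu
      exact ⟨fun _ => hu, fun h => absurd hgW h⟩
    · filter_upwards [hc (hW.isClosed.isOpen_compl.mem_nhds hgW)] with u hu
      exact ⟨fun h => absurd h hgW, fun _ => hu⟩
  rw [eventually_inf_principal]
  filter_upwards [hev.comap fun γ : H × E => w + γ.1] with γ hγ hγΓ
  refine AgreeOut.locallyClose hε (agreeOut_of_forall fun x hx => ?_)
  have hst := hA.shift hγΓ
  constructor
  · rintro ⟨β, hβ, hβW, rfl⟩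
    rw [Prod.fst_add] at hβW
    rw [Prod.snd_add, add_zero] at hx ⊢
    refine hst.mem_of_interior β hβ (((hγ.2 β ⟨hβ, ⟨(g + β.1, g), ⟨?_, ?_⟩, ?_⟩, hx⟩).1) ?_)
    · rwa [add_comm]
    · exact mem_of_mem_nhds hgK
    · simp
    · rwa [add_comm]
  · intro hxA
    obtain ⟨β, hβ, rfl, hβW⟩ := hst.exists_lattice x hxA
    refine ⟨β, hβ, ?_, by simp⟩
    by_contra hn
    refine (hγ.2 β ⟨hβ, ⟨(w + γ.1 + β.1, w + γ.1), ⟨hβW, hγ.1⟩, by simp⟩, hx⟩).2 ?_ hβW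
    rwa [Prod.fst_add, add_comm] at hn

/-- Elements of the hull with the same torus parameter are proximal, hence are not separated by
any equicontinuous factor. -/
theorem IsModelSet.maxEquicontinuousRel [LocallyCompactSpace H] (hW : IsWindow W)
    (hM : S.IsModelSet W M) {A B : Set E} (hA : A ∈ hull M) (hB : B ∈ hull M) {w : H}
    (hwA : S.IsStarParameter W w A) (hwB : S.IsStarParameter W w B) :
    MaxEquicontinuousRel M A B := by
  refine ⟨hA, hB, ?_⟩
  intro Y _ _ _ _ _ π hπ
  obtain ⟨ξ, hξ, -⟩ := hM
  have hg : S.IsNonsingular W (ξ.1, 0) := by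
    intro γ hγ
    simpa using hξ γ hγ
  set l := comap (fun γ : H × E => w + γ.1) (𝓝 ξ.1) ⊓ 𝓟 (S.lattice : Set (H × E))
  have hl : l.NeBot := by
    refine (nhds_basis_opens ξ.1).comap _ |>.inf_principal_neBot_iff.2 ?_
    rintro U ⟨hmem, hU⟩
    obtain ⟨γ, hγ, hγU⟩ := S.exists_lattice_mem_of_isOpen w hU ⟨_, hmem⟩
    exact ⟨γ, hγU, hγ⟩
  have hlatt : ∀ᶠ γ in l, γ ∈ S.lattice := mem_inf_of_right (mem_principal_self _)
  have hN : S.projectionSet W (ξ.1, 0) ∈ hull M :=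
    isClosed_closure.mem_of_tendsto (hwA.tendsto_shift hW.isCompact hg)
      (Eventually.of_forall fun γ => shift_mem_hull hA γ.2)
  have key : ∀ D ∈ hull M, S.IsStarParameter W w D →
      Tendsto (fun γ : H × E => (-γ.2) +ᵥ π D) l (𝓝 (π (S.projectionSet W (ξ.1, 0)))) := by
    intro D hD hwD
    have h1 : Tendsto (fun γ : H × E => _root_.shift D γ.2) l
        (𝓝[hull M] (S.projectionSet W (ξ.1, 0))) :=
      tendsto_nhdsWithin_iff.2 ⟨hwD.tendsto_shift hW.isCompact hg,
        Eventually.of_forall fun γ => shift_mem_hull hD γ.2⟩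
    refine ((hπ.continuousOn _ hN).tendsto.comp h1).congr fun γ => ?_
    exact hπ.equivariant D hD γ.2
  refine eq_of_uniformity fun {V} hV => ?_
  obtain ⟨V', hV', hsymm, hcomp⟩ := comp_symm_mem_uniformity_sets hV
  -- Equicontinuity at the common limit allows translating back by `γ.2`: both `π A` and `π B` are
  -- then close to the same translate of that limit.
  have heq := hπ.equicontinuous (π (S.projectionSet W (ξ.1, 0))) V' hV'
  obtain ⟨γ, hγA, hγB⟩ := (((key A hA hwA).eventually heq).and
    ((key B hB hwB).eventually heq)).exists
  have hAγ := hγA γ.2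
  have hBγ := hγB γ.2
  simp only [vadd_vadd, add_neg_cancel, zero_vadd] at hAγ hBγ
  exact hcomp ⟨_, hsymm.symm _ _ hAγ, hBγ⟩

end CutProjectScheme

/-! ### Affine functions from translation-invariant differences -/

section Affine
variable {V : Type*} [NormedAddCommGroup V] {U : Set V} {f : V → ℝ}

theorem translation_invariant_differences_of_dense (hU : IsOpen U) (hf : ContinuousOn f U)
    {D : Set V} (hD : Dense D)
    (h : ∀ v ∈ D, ∀ a ∈ U, ∀ b ∈ U, a + v ∈ U → b + v ∈ U → f (a + v) - f a = f (b + v) - f b)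
    {v a b : V} (ha : a ∈ U) (hb : b ∈ U) (hav : a + v ∈ U) (hbv : b + v ∈ U) :
    f (a + v) - f a = f (b + v) - f b := by
  have hne : (𝓝[D] v).NeBot := mem_closure_iff_nhdsWithin_neBot.1 (hD v)
  have hadd : ∀ c, c + v ∈ U → (∀ᶠ v' in 𝓝[D] v, c + v' ∈ U) ∧
      Tendsto (fun v' => f (c + v') - f c) (𝓝[D] v) (𝓝 (f (c + v) - f c)) := by
    intro c hc
    have h1 : Tendsto (fun v' => c + v') (𝓝[D] v) (𝓝 (c + v)) :=
      ((continuous_const_add c).tendsto v).mono_left nhdsWithin_le_nhds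
    exact ⟨h1 (hU.mem_nhds hc),
      (((hf.continuousAt (hU.mem_nhds hc)).tendsto.comp h1).sub_const (f c))⟩
  refine tendsto_nhds_unique_of_eventuallyEq (hadd a hav).2 (hadd b hbv).2 ?_
  filter_upwards [(hadd a hav).1, (hadd b hbv).1, self_mem_nhdsWithin] with v' h1 h2 h3
  exact h v' h3 a ha b hb h1 h2

/-- A continuous function on a convex open set is affine if its differences along a dense set of
vectors do not depend on the base point. -/
theorem exists_linear_of_translation_invariant_differences [NormedSpace ℝ V] (hU : IsOpen U) (hconv : Convex ℝ U)
    (hf : ContinuousOn f U) {D : Set V} (hD : Dense D)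
    (h : ∀ v ∈ D, ∀ a ∈ U, ∀ b ∈ U, a + v ∈ U → b + v ∈ U → f (a + v) - f a = f (b + v) - f b) :
    ∃ L : V →L[ℝ] ℝ, ∀ a ∈ U, ∀ b ∈ U, f b - f a = L (b - a) := by
  rcases U.eq_empty_or_nonempty with rfl | ⟨p, hp⟩
  · exact ⟨0, by simp⟩
  obtain ⟨ρ, hρ, hball⟩ := Metric.isOpen_iff.1 hU p hp
  have hpU : ∀ {w : V}, ‖w‖ < ρ → p + w ∈ U := fun {w} hw => hball (by simpa using hw)
  set g : V → ℝ := fun w => f (p + w) - f p with hg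
  have hstep : ∀ {a w : V}, a ∈ U → a + w ∈ U → ‖w‖ < ρ → f (a + w) - f a = g w :=
    fun ha haw hw => translation_invariant_differences_of_dense hU hf hD h ha hp haw (hpU hw)
  -- Convexity keeps all intermediate points in `U`, so the short steps telescope.
  have htel : ∀ (n : ℕ) {a w : V}, a ∈ U → a + (n : ℝ) • w ∈ U → ‖w‖ < ρ →
      f (a + (n : ℝ) • w) - f a = n * g w := by
    intro n
    induction n with
    | zero => intro a w _ _ _; simp
    | succ n ih =>
      intro a w ha haw hw
      have hmem : a + (n : ℝ) • w ∈ U := by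
        have hpos : (0 : ℝ) < n + 1 := by positivity
        have hseg := hconv.add_smul_mem ha haw (t := (n : ℝ) / (n + 1))
          ⟨by positivity, (div_le_one hpos).2 (by linarith)⟩
        rwa [smul_smul, Nat.cast_add, Nat.cast_one, div_mul_cancel₀ _ hpos.ne'] at hseg
      have heq : a + ((n + 1 : ℕ) : ℝ) • w = a + (n : ℝ) • w + w := by
        push_cast
        rw [add_smul, one_smul, add_assoc]
      rw [heq] at haw ⊢
      have h1 := ih ha hmem hw
      have h2 := hstep hmem haw hw
      push_cast
      linarith
  have hdiv : ∀ {w : V} {n : ℕ}, ‖w‖ < n * ρ → (n : ℝ) ≠ 0 ∧ ‖(n : ℝ)⁻¹ • w‖ < ρ := by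
    intro w n hw
    have hn : (0 : ℝ) < n := by
      by_contra hn
      nlinarith [norm_nonneg w]
    refine ⟨hn.ne', ?_⟩
    rw [norm_smul, norm_inv, Real.norm_natCast, inv_mul_lt_iff₀ hn]
    exact hw
  -- Cutting `w / n` further into `m` steps gives an expression symmetric in `n` and `m`, so `n * g
  -- (w / n)` does not depend on `n`.
  have hscale : ∀ {w : V} {n m : ℕ}, ‖w‖ < n * ρ → ‖w‖ < m * ρ →
      (n : ℝ) * g ((n : ℝ)⁻¹ • w) = n * (m * g ((m : ℝ)⁻¹ • (n : ℝ)⁻¹ • w)) := by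
    intro w n m hn hm
    obtain ⟨hn0, hn1⟩ := hdiv hn
    obtain ⟨hm0, hm1⟩ := hdiv hm
    have hn2 : (1 : ℝ) ≤ n := by
      exact_mod_cast Nat.one_le_iff_ne_zero.2 (by exact_mod_cast hn0)
    have hsmall : ‖(m : ℝ)⁻¹ • (n : ℝ)⁻¹ • w‖ < ρ := by
      rw [smul_comm, norm_smul, norm_inv, Real.norm_natCast]
      exact (mul_le_of_le_one_left (norm_nonneg _) (inv_le_one_of_one_le₀ hn2)).trans_lt hm1
    have := htel m (a := p) (w := (m : ℝ)⁻¹ • (n : ℝ)⁻¹ • w) hp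
      (by rw [smul_inv_smul₀ hm0]; exact hpU hn1) hsmall
    rw [smul_inv_smul₀ hm0] at this
    rw [← this]
  have hindep : ∀ {w : V} {n m : ℕ}, ‖w‖ < n * ρ → ‖w‖ < m * ρ →
      (n : ℝ) * g ((n : ℝ)⁻¹ • w) = m * g ((m : ℝ)⁻¹ • w) := by
    intro w n m hn hm
    rw [hscale hn hm, hscale hm hn, smul_comm]
    ring
  choose N hN using fun w : V => (exists_nat_gt (‖w‖ / ρ)).imp fun n hn => (div_lt_iff₀ hρ).1 hn
  have hval : ∀ {w : V} {n : ℕ}, ‖w‖ < n * ρ →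
      (N w : ℝ) * g ((N w : ℝ)⁻¹ • w) = n * g ((n : ℝ)⁻¹ • w) := fun hn => hindep (hN _) hn
  have hsmallval : ∀ {w : V}, ‖w‖ < ρ → (N w : ℝ) * g ((N w : ℝ)⁻¹ • w) = g w := by
    intro w hw
    simpa using hval (w := w) (n := 1) (by simpa using hw)
  let T : V →+ ℝ := AddMonoidHom.mk' (fun w => (N w : ℝ) * g ((N w : ℝ)⁻¹ • w)) (by
    intro v w
    -- One subdivision fine enough for `v`, `w` and `v + w` at once.
    obtain ⟨n, hn⟩ := exists_nat_gt ((‖v‖ + ‖w‖) / ρ)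
    rw [div_lt_iff₀ hρ] at hn
    have hv : ‖v‖ < n * ρ := by linarith [norm_nonneg w]
    have hw : ‖w‖ < n * ρ := by linarith [norm_nonneg v]
    have hvw : ‖v + w‖ < n * ρ := (norm_add_le v w).trans_lt hn
    rw [hval hv, hval hw, hval hvw]
    have h1 := hstep (a := p + (n : ℝ)⁻¹ • v) (w := (n : ℝ)⁻¹ • w) (hpU (hdiv hv).2)
      (by rw [add_assoc, ← smul_add]; exact hpU (hdiv hvw).2) (hdiv hw).2
    have h2 : g ((n : ℝ)⁻¹ • (v + w)) = g ((n : ℝ)⁻¹ • v) + g ((n : ℝ)⁻¹ • w) := by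
      rw [← h1, smul_add]
      simp only [hg, add_assoc]
      ring
    rw [h2]
    ring)
  have hT : ∀ w, T w = (N w : ℝ) * g ((N w : ℝ)⁻¹ • w) := fun w => rfl
  have hTcont : Continuous T := by
    refine continuous_of_continuousAt_zero T ?_
    have hgc : ContinuousAt g 0 := by
      have h1 : ContinuousAt f (p + 0) := by
        rw [add_zero]
        exact hf.continuousAt (hU.mem_nhds hp)
      exact (ContinuousAt.comp (f := fun w => p + w) h1
        (continuous_const_add p).continuousAt).sub continuousAt_const
    refine hgc.congr ?_
    filter_upwards [Metric.ball_mem_nhds (0 : V) hρ] with w hw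
    rw [hT, hsmallval (by simpa using hw)]
  refine ⟨T.toRealLinearMap hTcont, fun a ha b hb => ?_⟩
  rw [AddMonoidHom.coe_toRealLinearMap, hT]
  obtain ⟨hn0, hn1⟩ := hdiv (hN (b - a))
  have := htel (N (b - a)) (a := a) (w := (N (b - a) : ℝ)⁻¹ • (b - a)) ha
    (by rw [smul_inv_smul₀ hn0]; simpa using hb) hn1
  rw [smul_inv_smul₀ hn0] at this
  simpa using this

end Affine

/-- A continuous function on a compact set descends to the image under a continuous map through
which it factors. -/
theorem IsCompact.exists_continuousOn_image {X Y Z : Type*} [TopologicalSpace X]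
    [TopologicalSpace Y] [T2Space Y] [TopologicalSpace Z] [Nonempty Z] {K : Set X}
    (hK : IsCompact K) (hKc : IsClosed K) {h : X → Y} {G : X → Z} (hh : ContinuousOn h K)
    (hG : ContinuousOn G K) (hfac : ∀ a ∈ K, ∀ b ∈ K, h a = h b → G a = G b) :
    ∃ f : Y → Z, ContinuousOn f (h '' K) ∧ ∀ a ∈ K, G a = f (h a) := by
  classical
  let f : Y → Z := fun y => if hy : ∃ a ∈ K, h a = y then G hy.choose else Classical.arbitrary Z
  have hf : ∀ a ∈ K, G a = f (h a) := by
    intro a ha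
    have hy : ∃ b ∈ K, h b = h a := ⟨a, ha, rfl⟩
    have : f (h a) = G hy.choose := dif_pos hy
    rw [this]
    exact hfac _ ha _ hy.choose_spec.1 hy.choose_spec.2.symm
  refine ⟨f, continuousOn_iff_isClosed.2 fun t ht => ?_, hf⟩
  have hcl : IsClosed (K ∩ G ⁻¹' t) := hG.preimage_isClosed_of_isClosed hKc ht
  have hcomp : IsCompact (K ∩ G ⁻¹' t) := hK.of_isClosed_subset hcl inter_subset_left
  -- The preimage of a closed set under `f` is, within `h '' K`, the image of a compact set.
  refine ⟨h '' (K ∩ G ⁻¹' t), (hcomp.image_of_continuousOn (hh.mono inter_subset_left)).isClosed, ?_⟩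
  ext y
  constructor
  · rintro ⟨hy, a, ha, rfl⟩
    refine ⟨⟨a, ⟨ha, ?_⟩, rfl⟩, a, ha, rfl⟩
    rw [mem_preimage, hf a ha]
    exact hy
  · rintro ⟨⟨a, ⟨ha, hat⟩, rfl⟩, hy⟩
    refine ⟨?_, hy⟩
    rw [mem_preimage, ← hf a ha]
    exact hat

/-! ### Patches, acceptance domains and local factors of `F` -/

section Patches
variable {E : Type} [NormedAddCommGroup E]

/-- The patch of radius `R` of `A` around `x`, translated to the origin. -/
def patchAt (R : ℝ) (A : Set E) (x : E) : Set E := shift A x ∩ Metric.closedBall 0 R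

theorem zero_mem_patchAt {M : Set E} {R : ℝ} (hR : 0 ≤ R) {x : E} (hx : x ∈ M) : (0 : E) ∈ patchAt R M x :=
  ⟨by simpa, by simpa⟩

end Patches

namespace CutProjectScheme

variable {H : Type*} [AddCommGroup H] [TopologicalSpace H] {E : Type} [NormedAddCommGroup E]

/-- The set whose closure is the acceptance domain. -/
def openAcceptanceDomain (S : CutProjectScheme H E) (W : Set H) (B P : Set E) : Set H :=
  {w | (∀ γ ∈ S.lattice, γ.2 ∈ P → w + γ.1 ∈ interior W) ∧
    (∀ γ ∈ S.lattice, (∃ u ∈ W, ∃ v ∈ W, γ.1 = u - v) → γ.2 ∈ B → γ.2 ∉ P → w + γ.1 ∉ W)}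

theorem mem_interior_of_mem_openAcceptanceDomain {S : CutProjectScheme H E} {W : Set H} {B P : Set E} (h0 : (0 : E) ∈ P) {w : H}
    (hw : w ∈ S.openAcceptanceDomain W B P) : w ∈ interior W := by
  simpa using hw.1 0 S.lattice.zero_mem h0

theorem IsStarParameter.inter_eq_of_mem_openAcceptanceDomain {S : CutProjectScheme H E} {W : Set H} {w : H} {A B P : Set E}
    (hA : S.IsStarParameter W w A) (hP : P ⊆ S.displacements W ∩ B) (h0 : (0 : E) ∈ P)
    (hw : w ∈ S.openAcceptanceDomain W B P) : A ∩ B = P := by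
  have hwW := interior_subset (mem_interior_of_mem_openAcceptanceDomain h0 hw)
  ext a
  constructor
  · rintro ⟨ha, haB⟩
    obtain ⟨γ, hγ, rfl, hγW⟩ := hA.exists_lattice a ha
    by_contra haP
    exact hw.2 γ hγ ⟨_, hγW, _, hwW, by abel⟩ haB haP hγW
  · intro ha
    obtain ⟨⟨γ, hγ, -, rfl⟩, haB⟩ := hP ha
    exact ⟨hA.mem_of_interior γ hγ (hw.1 γ hγ ha), haB⟩

variable {S : CutProjectScheme H E} {W : Set H} [IsTopologicalAddGroup H] [T2Space H]
  [ProperSpace E] {M : Set E}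

/-- Only finitely many lattice points impose a condition, and each condition is open. -/
theorem isOpen_openAcceptanceDomain (hW : IsCompact W) {R : ℝ} {P : Set E}
    (hP : P ⊆ S.displacements W ∩ Metric.closedBall 0 R) :
    IsOpen (S.openAcceptanceDomain W (Metric.closedBall 0 R) P) := by
  have hWW : IsCompact ((fun p : H × H => p.1 - p.2) '' W ×ˢ W) :=
    (hW.prod hW).image (by fun_prop)
  have hfin := S.finite_lattice_inter hWW R
  have hfin₁ : {γ : H × E | γ ∈ S.lattice ∧ γ.2 ∈ P}.Finite := by
    refine hfin.subset ?_
    rintro γ ⟨hγ, hγP⟩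
    obtain ⟨⟨β, hβ, ⟨u, hu, v, hv, huv⟩, he⟩, hR⟩ := hP hγP
    rw [S.eq_of_snd_eq hβ hγ he] at huv
    exact ⟨hγ, ⟨(u, v), ⟨hu, hv⟩, huv.symm⟩, by simpa using hR⟩
  have hfin₂ : {γ : H × E | γ ∈ S.lattice ∧ (∃ u ∈ W, ∃ v ∈ W, γ.1 = u - v) ∧
      γ.2 ∈ Metric.closedBall 0 R ∧ γ.2 ∉ P}.Finite := by
    refine hfin.subset ?_
    rintro γ ⟨hγ, ⟨u, hu, v, hv, huv⟩, hR, -⟩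
    exact ⟨hγ, ⟨(u, v), ⟨hu, hv⟩, huv.symm⟩, by simpa using hR⟩
  have heq : S.openAcceptanceDomain W (Metric.closedBall 0 R) P =
      (⋂ γ ∈ {γ : H × E | γ ∈ S.lattice ∧ γ.2 ∈ P}, (fun w : H => w + γ.1) ⁻¹' interior W) ∩
      ⋂ γ ∈ {γ : H × E | γ ∈ S.lattice ∧ (∃ u ∈ W, ∃ v ∈ W, γ.1 = u - v) ∧
        γ.2 ∈ Metric.closedBall 0 R ∧ γ.2 ∉ P}, (fun w : H => w + γ.1) ⁻¹' Wᶜ := by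
    ext w
    simp only [openAcceptanceDomain, mem_ofPred_eq, mem_inter_iff, mem_iInter, mem_preimage,
      mem_compl_iff, and_imp]
  rw [heq]
  exact (hfin₁.isOpen_biInter fun γ _ => isOpen_interior.preimage (continuous_add_const γ.1)).inter
    (hfin₂.isOpen_biInter fun γ _ => hW.isClosed.isOpen_compl.preimage (continuous_add_const γ.1))

theorem IsModelSet.patchAt_subset (hW : IsWindow W) (hM : S.IsModelSet W M) {x : E} (hx : x ∈ M)
    (R : ℝ) : patchAt R M x ⊆ S.displacements W ∩ Metric.closedBall 0 R :=
  inter_subset_inter_left _ (hM.shift_subset_displacements hW hx)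

theorem IsModelSet.finite_patchAt (hW : IsWindow W) (hM : S.IsModelSet W M) (R : ℝ) :
    (patchAt R M '' M).Finite := by
  refine ((S.isLocallyFiniteSet_displacements hW.isCompact).finite_patches
    (𝒮 := (fun x : E => _root_.shift M x) '' M) ?_ R).subset ?_
  · rintro _ ⟨x, hx, rfl⟩
    exact hM.shift_subset_displacements hW hx
  · rintro _ ⟨x, hx, rfl⟩
    exact ⟨_, ⟨x, hx, rfl⟩, rfl⟩

/-- The nonsingular approximants eventually share the patch, and their parameters avoid the frontier
conditions, so they lie in the open domain; the limit lies in its closure. -/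
theorem IsModelSet.starMap_mem_acceptanceDomain (hW : IsWindow W) (hM : S.IsModelSet W M) {x : E}
    (hx : x ∈ M) (R : ℝ) :
    S.starMap W M x ∈ S.acceptanceDomain W (Metric.closedBall 0 R) (patchAt R M x) := by
  obtain ⟨w, hw, v, hv, hag, hev⟩ := hM.exists_tendsto hW hx
  rw [(hM.isStarParameter_starMap hW hx).unique hW hw]
  have := pointedFilter_neBot hx hM.mem_closure
  refine mem_closure_of_tendsto hv ?_
  filter_upwards [hag R, hev] with p hp hp'
  obtain ⟨hst, -, hns⟩ := hp'
  refine ⟨fun γ hγ hγP => ?_, fun γ hγ _ hγB hγP hγW => ?_⟩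
  · have hmem := hst.mem_window_of_mem hγ ((hp.mem_iff (by simpa using hγP.2)).1 hγP.1)
    by_contra hni
    exact hns γ hγ ⟨subset_closure hmem, hni⟩
  · have hint : v p + γ.1 ∈ interior W := by
      by_contra hni
      exact hns γ hγ ⟨subset_closure hγW, hni⟩
    exact hγP ⟨(hp.mem_iff (by simpa using hγB)).2 (hst.mem_of_interior γ hγ hint), hγB⟩

/-- A lattice translate of the star map that lands in the open acceptance domain is attained. -/
theorem IsModelSet.add_mem_of_mem_openAcceptanceDomain (hW : IsWindow W) (hM : S.IsModelSet W M)
    {R : ℝ} (hR : 0 ≤ R) {x y : E} (hx : x ∈ M) (hy : y ∈ M) {γ : H × E} (hγ : γ ∈ S.lattice)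
    (h : S.starMap W M y + γ.1 ∈
      S.openAcceptanceDomain W (Metric.closedBall 0 R) (patchAt R M x)) :
    y + γ.2 ∈ M ∧ S.starMap W M (y + γ.2) = S.starMap W M y + γ.1 ∧
      patchAt R M (y + γ.2) = patchAt R M x := by
  have hyM : y + γ.2 ∈ M := by
    have := (hM.isStarParameter_starMap hW hy).mem_of_interior γ hγ
      (mem_interior_of_mem_openAcceptanceDomain (zero_mem_patchAt hR hx) h)
    rwa [mem_shift, add_comm] at this
  have hs := hM.starMap_add hW hy hγ hyM
  refine ⟨hyM, hs, ?_⟩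
  exact (hM.isStarParameter_starMap hW hyM).inter_eq_of_mem_openAcceptanceDomain
    (hM.patchAt_subset hW hx R) (zero_mem_patchAt hR hx) (by rwa [hs])

/-- Star values of points of `M` with this patch are dense in the domain, and the image of the
compact `X` is closed. This gives the local factor a value on the whole acceptance domain. -/
theorem IsModelSet.acceptanceDomain_subset_image (hW : IsWindow W) (hM : S.IsModelSet W M)
    {R : ℝ} (hR : 0 ≤ R) {x : E} (hx : x ∈ M) {X : Set (Set E)}
    (hX : IsCompact X) (hXM : X ⊆ transversal M)
    (hmem : ∀ y ∈ M, patchAt R M y = patchAt R M x → _root_.shift M y ∈ X) :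
    S.acceptanceDomain W (Metric.closedBall 0 R) (patchAt R M x) ⊆
      (fun A => S.starMap W A 0) '' X := by
  have hcl : IsClosed ((fun A => S.starMap W A 0) '' X) :=
    (hX.image_of_continuousOn ((hM.continuousOn_starMap_zero hW).mono hXM)).isClosed
  refine closure_minimal (((S.dense_translate_internal (S.starMap W M x)).open_subset_closure_inter
    (isOpen_openAcceptanceDomain hW.isCompact (hM.patchAt_subset hW hx R))).trans
    (closure_minimal ?_ hcl)) hcl
  rintro _ ⟨hw, γ, hγ, rfl⟩
  obtain ⟨h1, h2, h3⟩ := hM.add_mem_of_mem_openAcceptanceDomain hW hR hx hx hγ hw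
  exact ⟨_, hmem _ h1 h3, (hM.starMap_shift_zero hW h1).trans h2⟩

/-- On the points with a given patch, a nonslip function is a continuous function of the star
map. -/
theorem IsModelSet.exists_continuousOn_acceptanceDomain [LocallyCompactSpace H] (hW : IsWindow W)
    (hM : S.IsModelSet W M) {F : M → ℝ} {G : Set E → ℝ} (hG : IsContinuousLift M F G) {R : ℝ}
    (hR : 0 ≤ R) (hns : ∀ A ∈ transversal M, ∀ B ∈ transversal M, MaxEquicontinuousRel M A B →
      AgreeOut R A B → G A = G B) {x : E} (hx : x ∈ M) :
    ∃ f : H → ℝ,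
      ContinuousOn f (S.acceptanceDomain W (Metric.closedBall 0 R) (patchAt R M x)) ∧
      ∀ y : M, patchAt R M y = patchAt R M x → F y = f (S.starMap W M y) := by
  set X : Set (Set E) := {A | A ∈ transversal M ∧ A ∩ Metric.closedBall 0 R = patchAt R M x} with hXdef
  have hXM : X ⊆ transversal M := fun A hA => hA.1
  have hXΔ : ∀ A ∈ X, A ⊆ S.displacements W :=
    fun A hA => hM.subset_displacements_of_mem_transversal hW hA.1
  have hΔ := S.isLocallyFiniteSet_displacements hW.isCompact
  have hXcl : IsClosed X := by
    refine isClosed_of_closure_subset fun A hA => ⟨?_, ?_⟩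
    · exact closure_minimal hXM isClosed_closure hA
    · obtain ⟨B, hB, hAB⟩ := hΔ.exists_agreeOut_of_mem_closure hXΔ hA R
      exact Eq.trans hAB hB.2
  have hXc := hΔ.isCompact_of_isClosed hXΔ hXcl
  obtain ⟨f, hf, hfG⟩ := hXc.exists_continuousOn_image hXcl
    ((hM.continuousOn_starMap_zero hW).mono hXM) (hG.1.mono hXM) (by
      intro A hA B hB hAB
      refine hns A hA.1 B hB.1 ?_ (Eq.trans hA.2 hB.2.symm)
      have hB' := hM.isStarParameter_of_mem_transversal hW hB.1
      rw [← show S.starMap W A 0 = S.starMap W B 0 from hAB] at hB'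
      exact hM.maxEquicontinuousRel hW (transversal_subset_hull M hA.1)
        (transversal_subset_hull M hB.1) (hM.isStarParameter_of_mem_transversal hW hA.1) hB')
  have hmem : ∀ y ∈ M, patchAt R M y = patchAt R M x → _root_.shift M y ∈ X :=
    fun y hy hyx => ⟨shift_mem_transversal hy, hyx⟩
  refine ⟨f, hf.mono (hM.acceptanceDomain_subset_image hW hR hx hXc hXM hmem), fun y hy => ?_⟩
  rw [hG.2 y, hfG _ (hmem y y.2 hy), hM.starMap_shift_zero hW y.2]

/-- A strongly pattern equivariant coboundary takes finitely many values on the pairs of points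
with a given displacement. -/
theorem IsModelSet.finite_coboundary (hW : IsWindow W) (hM : S.IsModelSet W M) {F : M → ℝ}
    (hcob : HasStronglyPECoboundary M F) (v : E) :
    {r : ℝ | ∃ x y : M, (y : E) = x + v ∧ r = F y - F x}.Finite := by
  obtain ⟨R, -, hR⟩ := hcob ‖v‖
  refine ((hM.finite_patchAt hW R).biUnion (t := fun P =>
    {r : ℝ | ∃ x y : M, (y : E) = x + v ∧ r = F y - F x ∧ patchAt R M x = P}) ?_).subset ?_
  · rintro P -
    refine Set.Subsingleton.finite ?_
    rintro _ ⟨x, y, hxy, rfl, hx⟩ _ ⟨x', y', hxy', rfl, hx'⟩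
    refine hR x y x' y' (by rw [hxy, hxy']; abel) (by rw [hxy]; simp) ?_
    exact Eq.trans hx hx'.symm
  · rintro _ ⟨x, y, hxy, rfl⟩
    exact mem_biUnion (mem_image_of_mem _ x.2) ⟨x, y, hxy, rfl, rfl⟩

/-- The difference of two local factors along a lattice vector is constant on connected sets. -/
theorem IsModelSet.constant_difference (hW : IsWindow W) (hM : S.IsModelSet W M) {F : M → ℝ}
    (hcob : HasStronglyPECoboundary M F) {R : ℝ} (hR : 0 ≤ R) {x x' : E} (hx : x ∈ M)
    (hx' : x' ∈ M) {f f' : H → ℝ}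
    (hf : ContinuousOn f (S.acceptanceDomain W (Metric.closedBall 0 R) (patchAt R M x)))
    (hfF : ∀ y : M, patchAt R M y = patchAt R M x → F y = f (S.starMap W M y))
    (hf' : ContinuousOn f' (S.acceptanceDomain W (Metric.closedBall 0 R) (patchAt R M x')))
    (hfF' : ∀ y : M, patchAt R M y = patchAt R M x' → F y = f' (S.starMap W M y))
    {γ : H × E} (hγ : γ ∈ S.lattice) {N : Set H} (hN : IsOpen N) (hNc : IsPreconnected N)
    (hNx : N ⊆ S.acceptanceDomain W (Metric.closedBall 0 R) (patchAt R M x))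
    (hNx' : ∀ w ∈ N, w + γ.1 ∈ S.acceptanceDomain W (Metric.closedBall 0 R) (patchAt R M x'))
    {a b : H} (ha : a ∈ N) (hb : b ∈ N) : f' (a + γ.1) - f a = f' (b + γ.1) - f b := by
  have hfin := hM.finite_coboundary hW hcob γ.2
  set T := {r : ℝ | ∃ x y : M, (y : E) = x + γ.2 ∧ r = F y - F x}
  have hd : ContinuousOn (fun w => f' (w + γ.1) - f w) N :=
    (hf'.comp (continuous_add_const γ.1).continuousOn hNx').sub (hf.mono hNx)
  -- Were some value outside the closed set `T`, this would persist on an open set. That set can be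
  -- shrunk into the open domain of the first patch, and then so that its translate lies in that of
  -- the second. By density a point of `M` has its star value there, and the difference is then a
  -- coboundary value, a contradiction.
  have hT : MapsTo (fun w => f' (w + γ.1) - f w) N T := by
    intro u hu
    by_contra huT
    have hO := isOpen_openAcceptanceDomain hW.isCompact (hM.patchAt_subset hW hx R)
    have hO' := (isOpen_openAcceptanceDomain hW.isCompact (hM.patchAt_subset hW hx' R)).preimage
      (continuous_add_const γ.1)
    have hN₁ : IsOpen (N ∩ (fun w => f' (w + γ.1) - f w) ⁻¹' Tᶜ) :=
      hd.isOpen_inter_preimage hN hfin.isClosed.isOpen_compl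
    obtain ⟨u₁, hu₁, hu₁O⟩ := mem_closure_iff.1 (hNx hu) _ hN₁ ⟨hu, huT⟩
    have hN₂ := hN₁.inter hO
    obtain ⟨u₂, hu₂, hu₂O⟩ := mem_closure_iff.1 (hNx' u₁ hu₁.1) _
      (hN₂.preimage (continuous_add_const (-γ.1))) (by
        rw [mem_preimage, add_neg_cancel_right]
        exact ⟨hu₁, hu₁O⟩)
    obtain ⟨β, hβ, ⟨⟨-, hβT⟩, hβO⟩, hβO'⟩ := S.exists_lattice_mem_of_isOpen (S.starMap W M x)
      (hN₂.inter hO') ⟨u₂ + -γ.1, hu₂, by rwa [mem_preimage, neg_add_cancel_right]⟩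
    obtain ⟨h1, h2, h3⟩ := hM.add_mem_of_mem_openAcceptanceDomain hW hR hx hx hβ hβO
    rw [mem_preimage, ← h2] at hβO'
    obtain ⟨h1', h2', h3'⟩ := hM.add_mem_of_mem_openAcceptanceDomain hW hR hx' h1 hγ hβO'
    refine hβT ⟨⟨_, h1⟩, ⟨_, h1'⟩, rfl, ?_⟩
    rw [hfF ⟨_, h1⟩ h3, hfF' ⟨_, h1'⟩ h3']
    simp only [h2, h2']
  exact hNc.constant_of_mapsTo hfin.isDiscrete hd hT ha hb

end CutProjectScheme

/-! ### Linear parts on sectors -/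

theorem ContinuousLinearMap.eq_of_sub_eq {V : Type*} [NormedAddCommGroup V] [NormedSpace ℝ V]
    {L L' : V →L[ℝ] ℝ} {U : Set V} (hU : IsOpen U) {a : V} (ha : a ∈ U)
    (h : ∀ b ∈ U, L (b - a) = L' (b - a)) : L = L' := by
  have hmem : {v | a + v ∈ U} ⊆ (LinearMap.eqLocus (L : V →ₗ[ℝ] ℝ) (L' : V →ₗ[ℝ] ℝ) : Set V) := by
    intro v hv
    simpa using h _ hv
  -- The equalizer is a subspace containing a neighbourhood of `0`.
  have htop := Submodule.eq_top_of_nonempty_interior' _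
    ⟨0, interior_maximal hmem (hU.preimage (continuous_const_add a)) (by simpa using ha)⟩
  ext v
  have : v ∈ LinearMap.eqLocus (L : V →ₗ[ℝ] ℝ) (L' : V →ₗ[ℝ] ℝ) := htop ▸ Submodule.mem_top
  exact this

namespace CutProjectScheme

variable {V C : Type*} [NormedAddCommGroup V] [AddCommGroup C] [TopologicalSpace C]
  [DiscreteTopology C] {E : Type} [NormedAddCommGroup E] {S : CutProjectScheme (V × C) E}

/-- Translations that preserve each copy of `V` suffice because `V × {0}` is open, `C` being
discrete. -/
theorem dense_internal_directions (S : CutProjectScheme (V × C) E) :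
    Dense {v : V | ∃ γ ∈ S.lattice, γ.1 = (v, 0)} := by
  refine dense_iff_inter_open.2 fun U hU ⟨u, hu⟩ => ?_
  obtain ⟨⟨v, c⟩, ⟨hv, hc⟩, γ, hγ, he⟩ := S.dense_internal.inter_open_nonempty (U ×ˢ {(0 : C)})
    (hU.prod (isOpen_discrete _)) ⟨(u, 0), hu, rfl⟩
  obtain rfl : c = 0 := hc
  exact ⟨v, hv, γ, hγ, he⟩

variable [NormedSpace ℝ V] [ProperSpace E] {W : Set (V × C)} {M : Set E}

theorem IsModelSet.constant_difference_of_convex (hW : IsWindow W) (hM : S.IsModelSet W M)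
    {F : M → ℝ} (hcob : HasStronglyPECoboundary M F) {R : ℝ} (hR : 0 ≤ R) {x x' : E} (hx : x ∈ M)
    (hx' : x' ∈ M) {f f' : V × C → ℝ}
    (hf : ContinuousOn f (S.acceptanceDomain W (Metric.closedBall 0 R) (patchAt R M x)))
    (hfF : ∀ y : M, patchAt R M y = patchAt R M x → F y = f (S.starMap W M y))
    (hf' : ContinuousOn f' (S.acceptanceDomain W (Metric.closedBall 0 R) (patchAt R M x')))
    (hfF' : ∀ y : M, patchAt R M y = patchAt R M x' → F y = f' (S.starMap W M y))
    {U U' : Set V} (hU : IsOpen U) (hUc : Convex ℝ U) (hU' : IsOpen U') (hUc' : Convex ℝ U')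
    {c c' : C}
    (hUx : U ×ˢ {c} ⊆ S.acceptanceDomain W (Metric.closedBall 0 R) (patchAt R M x))
    (hUx' : U' ×ˢ {c'} ⊆ S.acceptanceDomain W (Metric.closedBall 0 R) (patchAt R M x'))
    {γ : (V × C) × E} (hγ : γ ∈ S.lattice) (hc : c + γ.1.2 = c') {a b : V} (ha : a ∈ U)
    (hb : b ∈ U) (ha' : a + γ.1.1 ∈ U') (hb' : b + γ.1.1 ∈ U') :
    f' (a + γ.1.1, c') - f (a, c) = f' (b + γ.1.1, c') - f (b, c) := by
  subst hc
  have hadd : ∀ u : V, ((u + γ.1.1, c + γ.1.2) : V × C) = (u, c) + γ.1 := fun u => rfl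
  rw [hadd, hadd]
  refine hM.constant_difference hW hcob hR hx hx' hf hfF hf' hfF' hγ
    (N := (U ∩ (fun u => u + γ.1.1) ⁻¹' U') ×ˢ {c}) ?_ ?_ ?_ ?_ ⟨⟨ha, ha'⟩, rfl⟩ ⟨⟨hb, hb'⟩, rfl⟩
  · exact (hU.inter (hU'.preimage (continuous_add_const _))).prod (isOpen_discrete _)
  · exact (hUc.inter (hUc'.translate_preimage_left γ.1.1)).isPreconnected.prod
      isPreconnected_singleton
  · exact (Set.prod_mono_left inter_subset_left).trans hUx
  · rintro ⟨u, k⟩ ⟨⟨-, hu⟩, hk⟩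
    obtain rfl : k = c := hk
    exact hUx' ⟨hu, rfl⟩

/-- A local factor is affine on each sector of the acceptance domain. -/
theorem IsModelSet.exists_linear_on_sector (hW : IsWindow W) (hM : S.IsModelSet W M)
    {F : M → ℝ} (hcob : HasStronglyPECoboundary M F) {R : ℝ} (hR : 0 ≤ R) {x : E} (hx : x ∈ M)
    {f : V × C → ℝ}
    (hf : ContinuousOn f (S.acceptanceDomain W (Metric.closedBall 0 R) (patchAt R M x)))
    (hfF : ∀ y : M, patchAt R M y = patchAt R M x → F y = f (S.starMap W M y))
    {K : Set V} (hK : Convex ℝ K) (hKi : (interior K).Nonempty) {c : C}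
    (hKx : K ×ˢ {c} ⊆ S.acceptanceDomain W (Metric.closedBall 0 R) (patchAt R M x)) :
    ∃ L : V →L[ℝ] ℝ, ∀ a ∈ K, ∀ b ∈ K, f (b, c) - f (a, c) = L (b - a) := by
  have hfK : ContinuousOn (fun u => f (u, c)) K :=
    hf.comp (Continuous.prodMk_left c).continuousOn fun u hu => hKx ⟨hu, rfl⟩
  have hUx : interior K ×ˢ {c} ⊆
      S.acceptanceDomain W (Metric.closedBall 0 R) (patchAt R M x) :=
    (Set.prod_mono_left interior_subset).trans hKx
  obtain ⟨L, hL⟩ := exists_linear_of_translation_invariant_differences isOpen_interior hK.interior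
    (hfK.mono interior_subset) S.dense_internal_directions (by
      rintro v ⟨γ, hγ, hv⟩ a ha b hb hav hbv
      obtain rfl : γ.1.1 = v := congrArg Prod.fst hv
      exact hM.constant_difference_of_convex hW hcob hR hx hx hf hfF hf hfF isOpen_interior
        hK.interior isOpen_interior hK.interior hUx hUx hγ (by rw [congrArg Prod.snd hv, add_zero])
        ha hb hav hbv)
  obtain ⟨p, hp⟩ := hKi
  -- Affinity passes from the interior to `K` by continuity, since a convex set with nonempty
  -- interior lies in the closure of that interior.
  have heq : EqOn (fun u => f (u, c)) (fun u => f (p, c) + L (u - p)) K := by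
    refine EqOn.of_subset_closure (s := interior K) (fun u hu => ?_) hfK (by fun_prop)
      interior_subset ?_
    · simp only [← hL p hp u hu]
      ring
    · rw [hK.closure_interior_eq_closure_of_nonempty_interior ⟨p, hp⟩]
      exact subset_closure
  refine ⟨L, fun a ha b hb => ?_⟩
  have h1 := heq ha
  have h2 := heq hb
  simp only at h1 h2
  rw [h1, h2, add_sub_add_left_eq_sub, ← map_sub, sub_sub_sub_cancel_right]

/-- The linear parts of the local factors on any two sectors agree. -/
theorem IsModelSet.linear_eq_of_sectors (hW : IsWindow W) (hM : S.IsModelSet W M)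
    {F : M → ℝ} (hcob : HasStronglyPECoboundary M F) {R : ℝ} (hR : 0 ≤ R) {x x' : E} (hx : x ∈ M)
    (hx' : x' ∈ M) {f f' : V × C → ℝ}
    (hf : ContinuousOn f (S.acceptanceDomain W (Metric.closedBall 0 R) (patchAt R M x)))
    (hfF : ∀ y : M, patchAt R M y = patchAt R M x → F y = f (S.starMap W M y))
    (hf' : ContinuousOn f' (S.acceptanceDomain W (Metric.closedBall 0 R) (patchAt R M x')))
    (hfF' : ∀ y : M, patchAt R M y = patchAt R M x' → F y = f' (S.starMap W M y))
    {K K' : Set V} (hK : Convex ℝ K) (hKi : (interior K).Nonempty) (hK' : Convex ℝ K')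
    (hKi' : (interior K').Nonempty) {c c' : C}
    (hKx : K ×ˢ {c} ⊆ S.acceptanceDomain W (Metric.closedBall 0 R) (patchAt R M x))
    (hKx' : K' ×ˢ {c'} ⊆ S.acceptanceDomain W (Metric.closedBall 0 R) (patchAt R M x'))
    {L L' : V →L[ℝ] ℝ} (hL : ∀ a ∈ K, ∀ b ∈ K, f (b, c) - f (a, c) = L (b - a))
    (hL' : ∀ a ∈ K', ∀ b ∈ K', f' (b, c') - f' (a, c') = L' (b - a)) : L = L' := by
  obtain ⟨p, hp⟩ := hKi
  obtain ⟨p', hp'⟩ := hKi'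
  -- A lattice vector carrying an interior point of the first sector into the interior of the
  -- second; constancy of the difference near `p` then compares `L` with `L'`.
  obtain ⟨γ, hγ, hγU, hγc⟩ := S.exists_lattice_mem_of_isOpen (p, c)
    (isOpen_interior.prod (isOpen_discrete {c'})) ⟨(p', c'), hp', rfl⟩
  refine ContinuousLinearMap.eq_of_sub_eq
    (isOpen_interior.inter (isOpen_interior.preimage (continuous_add_const γ.1.1)))
    (a := p) (U := interior K ∩ (fun u => u + γ.1.1) ⁻¹' interior K') ⟨hp, hγU⟩ ?_
  rintro b ⟨hb, hb'⟩
  have h := hM.constant_difference_of_convex hW hcob hR hx hx' hf hfF hf' hfF' isOpen_interior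
    hK.interior isOpen_interior hK'.interior ((Set.prod_mono_left interior_subset).trans hKx)
    ((Set.prod_mono_left interior_subset).trans hKx') hγ hγc hp hb hγU hb'
  have h1 := hL p (interior_subset hp) b (interior_subset hb)
  have h2 := hL' _ (interior_subset hγU) _ (interior_subset hb')
  have h3 : b + γ.1.1 - ((p, c) + γ.1 : V × C).1 = b - p := by
    simp
  rw [h3] at h2
  rw [← h1, ← h2]
  have h4 : ((p, c) + γ.1 : V × C).1 = p + γ.1.1 := rfl
  rw [h4]
  linarith

end CutProjectScheme

/-- A function with finitely many values that extends continuously to a compact transversal is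
strongly pattern equivariant. -/
theorem isStronglyPE_of_finite_range {E : Type} [NormedAddCommGroup E] {M : Set E}
    (hM : IsCompact (transversal M)) {φ : M → ℝ} {G : Set E → ℝ} (hG : IsContinuousLift M φ G)
    (hfin : (range φ).Finite) : IsStronglyPE M φ := by
  -- `δ` is the smallest gap between values; uniform continuity of the lift turns agreement on a
  -- large ball into a difference below this gap.
  obtain ⟨δ, hδ, hsep⟩ : ∃ δ : ℝ, 0 < δ ∧ ∀ x y : M, dist (φ x) (φ y) < δ → φ x = φ y := by
    by_cases hT : (range φ).Nontrivial
    · refine ⟨(range φ).infsep, hfin.infsep_pos_iff_nontrivial.2 hT, fun x y h => ?_⟩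
      by_contra hne
      exact absurd (infsep_le_dist_of_mem (mem_range_self x) (mem_range_self y) hne) (not_le.2 h)
    · rw [not_nontrivial_iff] at hT
      exact ⟨1, one_pos, fun x y _ => hT (mem_range_self x) (mem_range_self y)⟩
  have huc := hM.uniformContinuousOn_of_continuous hG.1
  obtain ⟨ε, hε, h⟩ := ((hasBasis_uniformity_localUniformSpace.inf_principal _).tendsto_iff
    Metric.uniformity_basis_dist).1 huc δ hδ
  refine ⟨ε⁻¹, inv_pos.2 hε, fun x y hxy => hsep x y ?_⟩
  rw [hG.2, hG.2]
  exact h (shift M x, shift M y) ⟨hxy.locallyClose hε, shift_mem_transversal x.2,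
    shift_mem_transversal y.2⟩

/-! ### Assembling the decomposition -/

theorem IsSector.exists_eq {n : ℕ} {C : Type*} [TopologicalSpace C] [DiscreteTopology C]
    {K : Set (EuclideanSpace ℝ (Fin n) × C)} (hK : IsSector K) :
    ∃ (K₀ : Set (EuclideanSpace ℝ (Fin n))) (c : C), Convex ℝ K₀ ∧ (interior K₀).Nonempty ∧
      K = K₀ ×ˢ {c} := by
  obtain ⟨-, hi, K₀, c, hconv, rfl⟩ := hK
  rw [interior_prod_eq] at hi
  exact ⟨K₀, c, hconv, hi.fst, rfl⟩

theorem theorem4 {n d : ℕ} {C : Type*} [AddCommGroup C] [Finite C] [TopologicalSpace C]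
    [DiscreteTopology C]
    (S : CutProjectScheme (EuclideanSpace ℝ (Fin n) × C) (EuclideanSpace ℝ (Fin d)))
    (W : Set (EuclideanSpace ℝ (Fin n) × C)) (hW : CutProjectScheme.IsWindow W)
    (hconv : HasConvexAcceptanceDomains S W)
    (M : Set (EuclideanSpace ℝ (Fin d))) (hM : S.IsModelSet W M)
    (F : M → ℝ) (hF : IsWeaklyPE M F) (hns : IsNonslip M F)
    (hcob : HasStronglyPECoboundary M F) :
    ∃ (L : EuclideanSpace ℝ (Fin n) →L[ℝ] ℝ) (ψ : M → ℝ), IsStronglyPE M ψ ∧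
      ∀ x : M, F x = L (S.starMap W M x).1 + ψ x := by
  rcases isEmpty_or_nonempty M with hemp | hne
  · exact ⟨0, F, ⟨1, one_pos, fun x => hemp.elim x⟩, fun x => hemp.elim x⟩
  obtain ⟨x₀⟩ := hne
  obtain ⟨G, hG, ε, hε, hslip⟩ := hns
  have hR : 0 ≤ ε⁻¹ := (inv_pos.2 hε).le
  choose f hf hfF using fun x : M =>
    hM.exists_continuousOn_acceptanceDomain hW hG hR hslip x.2
  have hsec : ∀ x : M, ∃ 𝒦 : Set (Set (EuclideanSpace ℝ (Fin n) × C)), 𝒦.Finite ∧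
      (∀ K ∈ 𝒦, IsSector K) ∧
      S.acceptanceDomain W (Metric.closedBall 0 ε⁻¹) (patchAt ε⁻¹ M x) = ⋃₀ 𝒦 := fun x =>
    hconv _ (hM.of_mem_hull (shift_mem_hull (self_mem_hull M) (x : EuclideanSpace ℝ (Fin d)))) _
      (isCompact_closedBall _ _) (zero_mem_patchAt hR x.2)
  choose 𝒦 h𝒦fin h𝒦 h𝒦eq using hsec
  have hmem𝒦 : ∀ x y : M, patchAt ε⁻¹ M y = patchAt ε⁻¹ M x →
      ∃ K ∈ 𝒦 x, S.starMap W M y ∈ K := by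
    intro x y hxy
    have := hM.starMap_mem_acceptanceDomain hW y.2 ε⁻¹
    rwa [hxy, h𝒦eq] at this
  have hsub : ∀ x : M, ∀ K ∈ 𝒦 x,
      K ⊆ S.acceptanceDomain W (Metric.closedBall 0 ε⁻¹) (patchAt ε⁻¹ M x) := by
    intro x K hK
    rw [h𝒦eq]
    exact subset_sUnion_of_mem hK
  -- A reference sector, whose linear part serves as `L` for all the others.
  obtain ⟨K₁, hK₁, -⟩ := hmem𝒦 x₀ x₀ rfl
  obtain ⟨A₁, c₁, hA₁, hA₁i, rfl⟩ := (h𝒦 x₀ K₁ hK₁).exists_eq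
  obtain ⟨L, hL⟩ := hM.exists_linear_on_sector hW hcob hR x₀.2 (hf x₀) (hfF x₀) hA₁ hA₁i
    (hsub x₀ _ hK₁)
  have haff : ∀ x : M, ∀ K ∈ 𝒦 x, ∀ a ∈ K, ∀ b ∈ K, f x b - L b.1 = f x a - L a.1 := by
    intro x K hK
    obtain ⟨A, c, hA, hAi, rfl⟩ := (h𝒦 x K hK).exists_eq
    obtain ⟨L', hL'⟩ := hM.exists_linear_on_sector hW hcob hR x.2 (hf x) (hfF x) hA hAi
      (hsub x _ hK)
    obtain rfl := hM.linear_eq_of_sectors hW hcob hR x₀.2 x.2 (hf x₀) (hfF x₀) (hf x) (hfF x) hA₁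
      hA₁i hA hAi (hsub x₀ _ hK₁) (hsub x _ hK) hL hL'
    rintro ⟨a, _⟩ ⟨ha, rfl⟩ ⟨b, _⟩ ⟨hb, rfl⟩
    have := hL' a ha b hb
    rw [map_sub] at this
    linarith
  refine ⟨L, fun x => F x - L (S.starMap W M x).1, ?_, fun x => by ring⟩
  refine isStronglyPE_of_finite_range (hM.isCompact_transversal hW)
    (G := fun A => G A - L (S.starMap W A 0).1) ⟨hG.1.sub ?_, fun x => ?_⟩ ?_
  · exact (L.continuous.comp continuous_fst).comp_continuousOn (hM.continuousOn_starMap_zero hW)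
  · simp only [hG.2 x, hM.starMap_shift_zero hW x.2]
  -- Each sector contributes at most one value by `haff`; there are finitely many sectors for each
  -- patch and finitely many patches.
  · have hfinP : ∀ x : M, {r : ℝ | ∃ y : M, patchAt ε⁻¹ M y = patchAt ε⁻¹ M x ∧
        F y - L (S.starMap W M y).1 = r}.Finite := by
      intro x
      refine ((h𝒦fin x).biUnion (t := fun K => (fun u => f x u - L u.1) '' K) fun K hK => ?_).subset
        ?_
      · refine Set.Subsingleton.finite ?_
        rintro _ ⟨a, ha, rfl⟩ _ ⟨b, hb, rfl⟩
        exact haff x K hK b hb a ha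
      · rintro _ ⟨y, hy, rfl⟩
        obtain ⟨K, hK, hyK⟩ := hmem𝒦 x y hy
        exact mem_biUnion hK ⟨_, hyK, by simp only [hfF x y hy]⟩
    refine ((hM.finite_patchAt hW ε⁻¹).biUnion (t := fun P => {r : ℝ | ∃ y : M,
      patchAt ε⁻¹ M y = P ∧ F y - L (S.starMap W M y).1 = r}) ?_).subset ?_
    · rintro _ ⟨x, hx, rfl⟩
      exact hfinP ⟨x, hx⟩
    · rintro _ ⟨y, rfl⟩
      exact mem_biUnion (mem_image_of_mem _ y.2) ⟨y, rfl, rfl⟩
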